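/- Let $g\ge 0$ and $n\ge 1$ be integers with $n\mid g-1$, and put $m=2n$. Let $X$ be the compact Riemann surface of genus $g$ defined by $y^2=\prod_{i=1}^{r}(x-e_i)$ with pairwise distinct $e_i\in\mathbb{C}$ and $r\in\{2g+1,2g+2\}$, and let $B$ be its branch set, i.e. the set of ramification points of $x:X\to\mathbb{C}\cup\{\infty\}$. An $m$-spin divisor is a divisor $\theta$ on $X$ such that $m\theta$ is linearly equivalent to a canonical divisor; it is supported on $B$ if it is linearly equivalent to a divisor whose support is contained in $B$. Let $D=2p$ with $p\in B$, and put $k_0=-\frac{g(n-1)+n+1}{2n}$ (which need not be an integer). Then $B$ has $2g+2$ elements, and the following hold. (1) A divisor $\theta$ is an $m$-spin divisor supported on $B$ if and only if it is linearly equivalent to $$kD+\sum_{q\in T}q$$ for some integer $k$ with $k_0\le k\le\frac{g-1}{2n}$ and some subset $T\subseteq B$ with exactly $\frac{g-1-2nk}{n}$ elements. (2) If $k>k_0$, the representation in (1) is unique: if $(k,T)$ and $(k',T')$ are two pairs as in (1) with $k>k_0$ and $kD+\sum_{q\in T}q\sim k'D+\sum_{q\in T'}q$, then $k'=k$ and $T'=T$.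 (3) If $k=k_0$ (which can occur only if $k_0$ is an integer), then $T$ has $g+1$ elements, and for a pair $(k',T')$ as in (1) one has $kD+\sum_{q\in T}q\sim k'D+\sum_{q\in T'}q$ if and only if $k'=k$ and either $T'=T$ or $T'=B\setminus T$. (4) There are exactly $2^{2g}$ linear equivalence classes of $m$-spin divisors supported on $B$. -/

import Mathlib

open scoped Manifold ContDiff

noncomputable section

namespace RiemannSurface

section Divisors

variable {X : Type*} [TopologicalSpace X] [ChartedSpace ℂ X]

/-- `f` is a meromorphic function on `X` (its values at poles are irrelevant): read in the
preferred chart at every point, it is meromorphic there. -/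
def IsMeromorphic (f : X → ℂ) : Prop :=
  ∀ p : X, MeromorphicAt (f ∘ (chartAt ℂ p).symm) (chartAt ℂ p p)

/-- The order of `f` at `p`; it is `⊤` if `f` vanishes identically near `p`. -/
def ordAt (f : X → ℂ) (p : X) : WithTop ℤ :=
  meromorphicOrderAt (f ∘ (chartAt ℂ p).symm) (chartAt ℂ p p)

variable (X) in
/-- The group of principal divisors. A divisor on a compact Riemann surface is a finitely
supported function `X →₀ ℤ`. -/
def principalDivisors : AddSubgroup (X →₀ ℤ) where
  carrier := {D | ∃ f : X → ℂ, IsMeromorphic f ∧ ∀ p, ordAt f p = (D p : WithTop ℤ)}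
  zero_mem' := by
    refine ⟨fun _ => 1, fun p => MeromorphicAt.const 1 _, fun p => ?_⟩
    have h : ((fun _ : X => (1 : ℂ)) ∘ (chartAt ℂ p).symm) = fun _ => (1 : ℂ) := rfl
    simp [ordAt, h, meromorphicOrderAt_const]
  add_mem' := by
    rintro D E ⟨f, hf, hfD⟩ ⟨h, hh, hhE⟩
    refine ⟨f * h, fun p => (hf p).mul (hh p), fun p => ?_⟩
    have := meromorphicOrderAt_mul (hf p) (hh p)
    rw [Finsupp.add_apply, WithTop.coe_add, ← hfD p, ← hhE p]
    exact this
  neg_mem' := by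
    rintro D ⟨f, hf, hfD⟩
    refine ⟨f⁻¹, fun p => (hf p).inv, fun p => ?_⟩
    have h : ordAt f⁻¹ p = - ordAt f p :=
      meromorphicOrderAt_inv (f := f ∘ (chartAt ℂ p).symm) (x := chartAt ℂ p p)
    rw [h, hfD p]
    rfl

/-- Linear equivalence of divisors. -/
def LinearlyEquivalent (D E : X →₀ ℤ) : Prop := D - E ∈ principalDivisors X

variable (X) in
/-- The group of divisors modulo linear equivalence. -/
abbrev DivisorClass : Type _ := (X →₀ ℤ) ⧸ principalDivisors X

/-- The coefficient `h` of the 1-form `η = h(z) dz` in the preferred chart at `p`. -/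
def formCoeff (η : ∀ q : X, TangentSpace 𝓘(ℂ) q →L[ℂ] ℂ) (p : X) (z : ℂ) : ℂ :=
  η ((chartAt ℂ p).symm z) (mfderiv 𝓘(ℂ) 𝓘(ℂ) (chartAt ℂ p).symm z (1 : ℂ))

/-- `K` is a canonical divisor: the divisor of a nonzero meromorphic 1-form `η` on `X`
(the values of `η` at its poles are irrelevant). -/
def IsCanonicalDivisor (K : X →₀ ℤ) : Prop :=
  ∃ η : ∀ q : X, TangentSpace 𝓘(ℂ) q →L[ℂ] ℂ, ∀ p : X,
    MeromorphicAt (formCoeff η p) (chartAt ℂ p p) ∧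
      meromorphicOrderAt (formCoeff η p) (chartAt ℂ p p) = (K p : WithTop ℤ)

/-- `θ` is an `m`-spin divisor: `m θ` is linearly equivalent to a canonical divisor. -/
def IsSpinDivisor (m : ℕ) (θ : X →₀ ℤ) : Prop :=
  ∃ K : X →₀ ℤ, IsCanonicalDivisor K ∧ LinearlyEquivalent (m • θ) K

/-- Up to linear equivalence, `θ` can be written in terms of points of `B` only. -/
def IsSupportedOn (B : Set X) (θ : X →₀ ℤ) : Prop :=
  ∃ θ' : X →₀ ℤ, LinearlyEquivalent θ θ' ∧ (θ'.support : Set X) ⊆ B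

end Divisors

/-- A presentation of the (compact) Riemann surface `X` as the hyperelliptic surface defined by
`y² = ∏ (x - e i)` with `2g + 1` or `2g + 2` distinct `e i`: meromorphic functions `x`, `y` on `X`
which map the complement of the poles of `x` biholomorphically (holomorphic, bijective, with
nowhere vanishing differential) onto the smooth affine curve with this equation. -/
structure HyperellipticModel (g : ℕ) (X : Type*) [TopologicalSpace X] [ChartedSpace ℂ X] where
  /-- the degree of the defining polynomial -/
  r : ℕ
  r_eq : r = 2 * g + 1 ∨ r = 2 * g + 2
  /-- the roots of the defining polynomial -/
  e : Fin r → ℂ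
  e_injective : Function.Injective e
  x : X → ℂ
  y : X → ℂ
  isMeromorphic_x : IsMeromorphic x
  isMeromorphic_y : IsMeromorphic y
  holomorphic_x : ∀ p, 0 ≤ ordAt x p → MDifferentiableAt 𝓘(ℂ) 𝓘(ℂ) x p
  holomorphic_y : ∀ p, 0 ≤ ordAt x p → MDifferentiableAt 𝓘(ℂ) 𝓘(ℂ) y p
  bijOn : Set.BijOn (fun p => (x p, y p)) {p | 0 ≤ ordAt x p}
    {ab : ℂ × ℂ | ab.2 ^ 2 = ∏ i, (ab.1 - e i)}
  immersion : ∀ p, 0 ≤ ordAt x p →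
    mfderiv 𝓘(ℂ) 𝓘(ℂ) x p ≠ 0 ∨ mfderiv 𝓘(ℂ) 𝓘(ℂ) y p ≠ 0

namespace HyperellipticModel

variable {g : ℕ} {X : Type*} [TopologicalSpace X] [ChartedSpace ℂ X]

/-- The branch set `B(X)`, i.e. the set of ramification points of the projection `x` from `X` to
the Riemann sphere: the points where `x` has a pole of order at least two, or where `x` is finite
and takes its value with multiplicity at least two. -/
def branchSet (H : HyperellipticModel g X) : Set X :=
  {p | ordAt H.x p ≤ -2 ∨ (0 ≤ ordAt H.x p ∧ 2 ≤ ordAt (fun q => H.x q - H.x p) p)}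

/-- The lower end of the range of `k`. -/
def lowest (g n : ℕ) : ℚ := ((g : ℚ) * (n - 1) + n + 1) / (-2 * n)

/-- `k` lies in the admissible range and `T` is a set of `(g - 1 - 2nk)/n` branch points. -/
def IsAdmissible (H : HyperellipticModel g X) (n : ℕ) (k : ℤ) (T : Finset X) : Prop :=
  lowest g n ≤ (k : ℚ) ∧ (k : ℚ) ≤ ((g : ℚ) - 1) / (2 * n) ∧
    (T : Set X) ⊆ H.branchSet ∧ (T.card : ℚ) = ((g : ℚ) - 1 - 2 * n * k) / n

end HyperellipticModel

/-- The divisor `k D + ∑_{p ∈ T} p`. -/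
def mumfordDivisor {X : Type*} (D : X →₀ ℤ) (k : ℤ) (T : Finset X) : X →₀ ℤ :=
  k • D + ∑ p ∈ T, Finsupp.single p 1

end RiemannSurface

end

open Filter Topology Set

namespace RiemannSurface

/-! ### Local analysis of holomorphic functions of one variable. -/

section LocalAnalysis

/-! Everything follows from the relations between branch points modulo principal divisors. The
function `x - e i` shows that `2b` is equivalent to the polar divisor of `x` for every `b ∈ B`, so
`2b ∼ 2p = D`. The function `y` gives `∑_{b ∈ B} b ∼ (g + 1) D`, and the form `dx / y` shows that
`(g - 1) D` is canonical.

The essential point is that there are no further relations: a principal divisor `A` supported on `B`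
has degree zero, and its coefficients are all even or all odd (`sum_eq_zero_and_even_or_odd`). If
`f` has divisor `A`, then `f² ∏ (x - e i) ^ (-A b_i)` has order zero wherever `x` is finite and the
same order at all poles of `x`. It or its inverse is therefore holomorphic on a compact connected
surface, hence constant, which gives the degree. Moreover `f²` takes equal values at conjugate
points `(x, ±y)`, so `f` changes there by a sign. This sign is constant because `ℂ` minus the roots
is connected. At a finite branch point `y` is an odd local coordinate, so the sign is `(-1)` to the
order of `f`: all these orders have one parity. A branch point at infinity is covered by the degree.

The rest is combinatorics. Put `e = (g - 1) / n`. A divisor supported on `B` is `m`-spin exactly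
when its degree is `e`. Reducing coefficients modulo 2 brings it to the form `kD + ∑_T q` with `2k +
|T| = e`; the only ambiguity is passing from `T` to `B \ T`, and `k ≥ k₀` means `|T| ≤ g + 1`.
Counting subsets up to complement, with the parity prescribed by `e`, gives `2 ^ (2g)`.

The model describes only the affine curve, so the number and nature of the poles of `x` have to be
derived from compactness and the Hausdorff property (`exists_finset_poles`). -/

theorem exists_analyticAt_pow_eq {h : ℂ → ℂ} {a : ℂ} (hh : AnalyticAt ℂ h a) (h0 : h a ≠ 0)
    {k : ℕ} (hk : k ≠ 0) :
    ∃ ψ : ℂ → ℂ, AnalyticAt ℂ ψ a ∧ ψ a ≠ 0 ∧ ∀ᶠ z in 𝓝 a, ψ z ^ k = h z := by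
  -- Dividing by `h a` keeps the argument of the logarithm near 1, away from the branch cut.
  refine ⟨fun z => Complex.exp (Complex.log (h a) / k) *
    Complex.exp (Complex.log (h z / h a) / k), ?_, by simp [Complex.exp_ne_zero], ?_⟩
  · have h1 : h a / h a ∈ Complex.slitPlane := by simp [h0]
    have h2 : AnalyticAt ℂ (fun z => Complex.log (h z / h a)) a :=
      (hh.div analyticAt_const h0).clog h1
    exact analyticAt_const.mul (h2.div analyticAt_const (by exact_mod_cast hk)).cexp
  · filter_upwards [hh.continuousAt.eventually_ne h0] with z hz
    have hk' : (k : ℂ) ≠ 0 := by exact_mod_cast hk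
    rw [mul_pow, ← Complex.exp_nat_mul, ← Complex.exp_nat_mul, mul_div_cancel₀ _ hk',
      mul_div_cancel₀ _ hk', Complex.exp_log h0, Complex.exp_log (div_ne_zero hz h0),
      mul_div_cancel₀ _ h0]

theorem exists_injOn_of_deriv_ne_zero {f : ℂ → ℂ} {a : ℂ} (hf : AnalyticAt ℂ f a)
    (h0 : deriv f a ≠ 0) : ∃ s ∈ 𝓝 a, InjOn f s := by
  obtain ⟨s, hs, hs'⟩ := (HasStrictDerivAt.eventually_left_inverse
    (hf := hf.hasStrictDerivAt) (hf' := h0)).exists_mem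
  refine ⟨s, hs, fun x hx y hy hxy => ?_⟩
  rw [← hs' x hx, hxy, hs' y hy]

/-- Near `a`, `f - f a = w ^ k` with `w` a local coordinate. If `k > 1`, the points where `w` equals
`t` and `ζ t`, for a primitive `k`-th root of unity `ζ`, have the same image. -/
theorem deriv_ne_zero_of_injOn {f : ℂ → ℂ} {a : ℂ} (hf : AnalyticAt ℂ f a)
    {s : Set ℂ} (hs : s ∈ 𝓝 a) (hinj : InjOn f s) : deriv f a ≠ 0 := by
  have hfa : AnalyticAt ℂ (fun z => f z - f a) a := hf.sub analyticAt_const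
  have hfin : analyticOrderAt (fun z => f z - f a) a ≠ ⊤ := by
    intro h
    rw [analyticOrderAt_eq_top] at h
    have h1 : ∀ᶠ z in 𝓝[≠] a, False := by
      filter_upwards [h.filter_mono nhdsWithin_le_nhds, mem_nhdsWithin_of_mem_nhds hs,
        self_mem_nhdsWithin] with z hz hzs hne
      exact hne (hinj hzs (mem_of_mem_nhds hs) (sub_eq_zero.1 hz))
    obtain ⟨_, h⟩ := h1.exists
    exact h
  obtain ⟨k, hk⟩ := ENat.ne_top_iff_exists.1 hfin
  obtain ⟨h, hh, h0, hfh⟩ := (hfa.analyticOrderAt_eq_natCast).1 hk.symm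
  have hk0 : k ≠ 0 := by
    rintro rfl
    have := hfh.self_of_nhds
    simp at this
    exact h0 this.symm
  obtain ⟨ψ, hψ, hψ0, hψh⟩ := exists_analyticAt_pow_eq hh h0 hk0
  set w : ℂ → ℂ := fun z => (z - a) * ψ z with hw
  have hwa : HasStrictDerivAt w (ψ a) a := by
    have h1 : HasStrictDerivAt (fun z : ℂ => z - a) 1 a := (hasStrictDerivAt_id a).sub_const a
    simpa [hw] using! h1.mul hψ.hasStrictDerivAt
  have hmap := hwa.map_nhds_eq hψ0
  have hwk : ∀ᶠ z in 𝓝 a, f z - f a = w z ^ k := by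
    filter_upwards [hfh, hψh] with z h1 h2
    rw [h1, ← h2, hw, mul_pow, smul_eq_mul]
  have hk1 : k = 1 := by
    by_contra hne
    obtain ⟨ζ, hζ⟩ : ∃ ζ : ℂ, IsPrimitiveRoot ζ k := ⟨_, Complex.isPrimitiveRoot_exp k hk0⟩
    have hU : s ∩ {z | f z - f a = w z ^ k} ∈ 𝓝 a := inter_mem hs hwk
    have hV : w '' (s ∩ {z | f z - f a = w z ^ k}) ∈ 𝓝 (0 : ℂ) := by
      have := image_mem_map (m := w) hU
      rw [hmap] at this
      simpa [hw] using! this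
    have hV' : ∀ᶠ t in 𝓝 (0 : ℂ), ζ * t ∈ w '' (s ∩ {z | f z - f a = w z ^ k}) := by
      have : Tendsto (fun t : ℂ => ζ * t) (𝓝 0) (𝓝 0) := by
        simpa using (continuous_const_mul ζ).tendsto (0 : ℂ)
      exact this hV
    obtain ⟨t, ⟨⟨z, hz, hzt⟩, ⟨z', hz', hzt'⟩⟩, ht⟩ :=
      ((((eventually_mem_set.2 hV).and hV').filter_mono nhdsWithin_le_nhds).and
        (self_mem_nhdsWithin (a := (0 : ℂ)) (s := {0}ᶜ))).exists
    have h1 : f z - f a = f z' - f a := by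
      rw [hz.2, hz'.2, hzt, hzt', mul_pow, hζ.pow_eq_one, one_mul]
    have h2 : z = z' := hinj hz.1 hz'.1 (sub_left_inj.1 h1)
    subst h2
    rw [hzt] at hzt'
    have h3 : ζ = 1 := by
      have : (ζ - 1) * t = 0 := by rw [sub_mul, ← hzt']; ring
      rcases mul_eq_zero.1 this with h | h
      · exact sub_eq_zero.1 h
      · exact absurd h ht
    rw [h3] at hζ
    exact hne (hζ.eq_orderOf.trans orderOf_one)
  subst hk1
  have h2 : HasStrictDerivAt (fun z => f z - f a) (ψ a) a :=
    hwa.congr_of_eventuallyEq (by filter_upwards [hwk] with z hz; rw [hz, pow_one])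
  have h3 : deriv f a = ψ a := by
    have := h2.hasDerivAt.deriv
    rwa [deriv_sub_const] at this
  rwa [h3]

theorem meromorphicOrderAt_sub_eq_one {f : ℂ → ℂ} {a : ℂ} (hf : AnalyticAt ℂ f a)
    (h0 : deriv f a ≠ 0) : meromorphicOrderAt (fun z => f z - f a) a = 1 := by
  have := hf.analyticOrderAt_sub_eq_one_of_deriv_ne_zero h0
  have h1 : AnalyticAt ℂ (fun z => f z - f a) a := hf.sub analyticAt_const
  rw [h1.meromorphicOrderAt_eq, this]
  rfl

end LocalAnalysis
end RiemannSurface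

namespace RiemannSurface

/-! ### Meromorphic functions read in charts. -/

section Charts

variable {X : Type*} [TopologicalSpace X] [ChartedSpace ℂ X]

theorem map_chartAt_symm_nhds (p : X) :
    map (chartAt ℂ p).symm (𝓝 (chartAt ℂ p p)) = 𝓝 p := by
  have := (chartAt ℂ p).symm.map_nhds_eq (mem_chart_target ℂ p)
  rwa [(chartAt ℂ p).left_inv (mem_chart_source ℂ p)] at this

theorem map_chartAt_nhds (p : X) : map (chartAt ℂ p) (𝓝 p) = 𝓝 (chartAt ℂ p p) :=
  (chartAt ℂ p).map_nhds_eq (mem_chart_source ℂ p)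

theorem map_chartAt_symm_nhdsNE (p : X) :
    map (chartAt ℂ p).symm (𝓝[≠] (chartAt ℂ p p)) = 𝓝[≠] p := by
  refine le_antisymm ?_ ?_
  · refine tendsto_nhdsWithin_iff.2 ⟨(map_chartAt_symm_nhds p).le.trans' (map_mono inf_le_left), ?_⟩
    filter_upwards [self_mem_nhdsWithin, nhdsWithin_le_nhds
      ((chartAt ℂ p).open_target.mem_nhds (mem_chart_target ℂ p))] with z hz hzt h
    apply hz
    rw [mem_singleton_iff] at h ⊢
    rw [← (chartAt ℂ p).right_inv hzt, h]
  · intro s hs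
    rw [mem_map, mem_nhdsWithin_iff_eventually] at hs
    rw [← map_chartAt_nhds p, eventually_map] at hs
    rw [mem_nhdsWithin_iff_eventually]
    filter_upwards [hs, (chartAt ℂ p).open_source.mem_nhds (mem_chart_source ℂ p)] with q hq hqs hne
    have h1 := hq (fun h => hne ((chartAt ℂ p).injOn hqs (mem_chart_source ℂ p) h))
    rwa [mem_preimage, (chartAt ℂ p).left_inv hqs] at h1

instance nhdsNE_neBot (p : X) : NeBot (𝓝[≠] p) := by
  rw [← map_chartAt_symm_nhdsNE p]
  infer_instance

theorem tendsto_comp_chartAt_symm_iff {f : X → ℂ} {p : X} {l : Filter ℂ} :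
    Tendsto (f ∘ (chartAt ℂ p).symm) (𝓝[≠] (chartAt ℂ p p)) l ↔ Tendsto f (𝓝[≠] p) l := by
  rw [← map_chartAt_symm_nhdsNE p, tendsto_map'_iff]

theorem eventually_chartAt_symm_iff {P : X → Prop} {p : X} :
    (∀ᶠ z in 𝓝[≠] (chartAt ℂ p p), P ((chartAt ℂ p).symm z)) ↔ ∀ᶠ q in 𝓝[≠] p, P q := by
  rw [← map_chartAt_symm_nhdsNE p, eventually_map]

theorem eventually_nhds_chartAt_symm_iff {P : X → Prop} {p : X} :
    (∀ᶠ z in 𝓝 (chartAt ℂ p p), P ((chartAt ℂ p).symm z)) ↔ ∀ᶠ q in 𝓝 p, P q := by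
  rw [← map_chartAt_symm_nhds p, eventually_map]

theorem ordAt_congr {f h : X → ℂ} {p : X} (hfh : f =ᶠ[𝓝[≠] p] h) : ordAt f p = ordAt h p :=
  meromorphicOrderAt_congr (eventually_chartAt_symm_iff.2 hfh)

theorem ordAt_mul {f h : X → ℂ} (hf : IsMeromorphic f) (hh : IsMeromorphic h) (p : X) :
    ordAt (fun q => f q * h q) p = ordAt f p + ordAt h p :=
  meromorphicOrderAt_mul (hf p) (hh p)

theorem ordAt_zpow {f : X → ℂ} (hf : IsMeromorphic f) (n : ℤ) (p : X) :
    ordAt (fun q => f q ^ n) p = n * ordAt f p :=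
  meromorphicOrderAt_zpow (hf p)

theorem ordAt_pow {f : X → ℂ} (hf : IsMeromorphic f) (n : ℕ) (p : X) :
    ordAt (fun q => f q ^ n) p = n * ordAt f p :=
  meromorphicOrderAt_pow (hf p)

theorem ordAt_inv (f : X → ℂ) (p : X) : ordAt (fun q => (f q)⁻¹) p = - ordAt f p :=
  meromorphicOrderAt_inv (f := f ∘ (chartAt ℂ p).symm) (x := chartAt ℂ p p)

theorem ordAt_prod {ι : Type*} {s : Finset ι} {f : ι → X → ℂ}
    (hf : ∀ i, IsMeromorphic (f i)) (p : X) :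
    ordAt (fun q => ∏ i ∈ s, f i q) p = ∑ i ∈ s, ordAt (f i) p :=
  meromorphicOrderAt_fun_prod (fun i _ => hf i p)

theorem ordAt_const {c : ℂ} (hc : c ≠ 0) (p : X) : ordAt (fun _ : X => c) p = 0 := by
  have h : ((fun _ : X => c) ∘ (chartAt ℂ p).symm) = fun _ => c := rfl
  simp [ordAt, h, meromorphicOrderAt_const, hc]

theorem IsMeromorphic.mul {f h : X → ℂ} (hf : IsMeromorphic f) (hh : IsMeromorphic h) :
    IsMeromorphic (fun q => f q * h q) := fun p => (hf p).mul (hh p)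

theorem IsMeromorphic.inv {f : X → ℂ} (hf : IsMeromorphic f) :
    IsMeromorphic (fun q => (f q)⁻¹) := fun p => (hf p).inv

theorem IsMeromorphic.zpow {f : X → ℂ} (hf : IsMeromorphic f) (n : ℤ) :
    IsMeromorphic (fun q => f q ^ n) := fun p => (hf p).zpow n

theorem IsMeromorphic.pow {f : X → ℂ} (hf : IsMeromorphic f) (n : ℕ) :
    IsMeromorphic (fun q => f q ^ n) := fun p => (hf p).pow n

theorem IsMeromorphic.sub_const {f : X → ℂ} (hf : IsMeromorphic f) (c : ℂ) :
    IsMeromorphic (fun q => f q - c) := fun p => (hf p).sub (MeromorphicAt.const c _)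

theorem IsMeromorphic.prod {ι : Type*} {s : Finset ι} {f : ι → X → ℂ}
    (hf : ∀ i, IsMeromorphic (f i)) : IsMeromorphic (fun q => ∏ i ∈ s, f i q) :=
  fun p => MeromorphicAt.fun_prod (F := fun i => f i ∘ (chartAt ℂ p).symm) (fun i _ => hf i p)

theorem IsMeromorphic.tendsto_nhds_iff {f : X → ℂ} (hf : IsMeromorphic f) {p : X} :
    (∃ c, Tendsto f (𝓝[≠] p) (𝓝 c)) ↔ 0 ≤ ordAt f p := by
  rw [ordAt, ← tendsto_nhds_iff_meromorphicOrderAt_nonneg (hf p)]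
  simp_rw [tendsto_comp_chartAt_symm_iff]

theorem IsMeromorphic.tendsto_ne_zero_iff {f : X → ℂ} (hf : IsMeromorphic f) {p : X} :
    (∃ c ≠ 0, Tendsto f (𝓝[≠] p) (𝓝 c)) ↔ ordAt f p = 0 := by
  rw [ordAt, ← tendsto_ne_zero_iff_meromorphicOrderAt_eq_zero (hf p)]
  simp_rw [tendsto_comp_chartAt_symm_iff]

theorem IsMeromorphic.tendsto_zero_iff {f : X → ℂ} (hf : IsMeromorphic f) {p : X} :
    Tendsto f (𝓝[≠] p) (𝓝 0) ↔ 0 < ordAt f p := by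
  rw [ordAt, ← tendsto_zero_iff_meromorphicOrderAt_pos (hf p), tendsto_comp_chartAt_symm_iff]

theorem IsMeromorphic.tendsto_cobounded_iff {f : X → ℂ} (hf : IsMeromorphic f) {p : X} :
    Tendsto f (𝓝[≠] p) (Bornology.cobounded ℂ) ↔ ordAt f p < 0 := by
  rw [ordAt, ← tendsto_cobounded_iff_meromorphicOrderAt_neg (hf p), tendsto_comp_chartAt_symm_iff]

theorem ordAt_nonneg_of_continuousAt {f : X → ℂ} (hf : IsMeromorphic f) {p : X}
    (h : ContinuousAt f p) : 0 ≤ ordAt f p :=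
  hf.tendsto_nhds_iff.1 ⟨f p, h.tendsto.mono_left nhdsWithin_le_nhds⟩

theorem IsMeromorphic.eventually_ne_zero {f : X → ℂ} (hf : IsMeromorphic f) {p : X}
    (h : ordAt f p ≠ ⊤) : ∀ᶠ q in 𝓝[≠] p, f q ≠ 0 :=
  eventually_chartAt_symm_iff.1
    ((meromorphicOrderAt_ne_top_iff_eventually_ne_zero (hf p)).1 h)

/-- The value of `f` at each point is replaced by the limit of `f` there. -/
noncomputable def limitFunction (f : X → ℂ) (p : X) : ℂ := limUnder (𝓝[≠] p) f

theorem limitFunction_eq_of_tendsto {f : X → ℂ} {p : X} {c : ℂ} (h : Tendsto f (𝓝[≠] p) (𝓝 c)) :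
    limitFunction f p = c := h.limUnder_eq

variable [IsManifold 𝓘(ℂ) ω X]

theorem mdifferentiableAt_of_analyticAt {f : X → ℂ} {p q : X}
    (hq : q ∈ (chartAt ℂ p).source)
    (h : DifferentiableAt ℂ (f ∘ (chartAt ℂ p).symm) (chartAt ℂ p q)) :
    MDifferentiableAt 𝓘(ℂ) 𝓘(ℂ) f q := by
  have h1 : MDifferentiableAt 𝓘(ℂ) 𝓘(ℂ) (chartAt ℂ p) q :=
    mdifferentiableAt_atlas (chart_mem_atlas ℂ p) hq
  have h2 : MDifferentiableAt 𝓘(ℂ) 𝓘(ℂ) (f ∘ (chartAt ℂ p).symm) (chartAt ℂ p q) :=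
    mdifferentiableAt_iff_differentiableAt.2 h
  refine (h2.comp q h1).congr_of_eventuallyEq ?_
  filter_upwards [(chartAt ℂ p).open_source.mem_nhds hq] with r hr
  simp [(chartAt ℂ p).left_inv hr]

theorem differentiableAt_of_mdifferentiableAt {f : X → ℂ} {p : X} {z : ℂ}
    (hz : z ∈ (chartAt ℂ p).target)
    (h : MDifferentiableAt 𝓘(ℂ) 𝓘(ℂ) f ((chartAt ℂ p).symm z)) :
    DifferentiableAt ℂ (f ∘ (chartAt ℂ p).symm) z := by
  have h1 : MDifferentiableAt 𝓘(ℂ) 𝓘(ℂ) (chartAt ℂ p).symm z :=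
    mdifferentiableAt_atlas_symm (chart_mem_atlas ℂ p) hz
  exact mdifferentiableAt_iff_differentiableAt.1 (h.comp z h1)

theorem analyticAt_of_eventually_mdifferentiableAt {f : X → ℂ} {p : X}
    (h : ∀ᶠ q in 𝓝 p, MDifferentiableAt 𝓘(ℂ) 𝓘(ℂ) f q) :
    AnalyticAt ℂ (f ∘ (chartAt ℂ p).symm) (chartAt ℂ p p) := by
  rw [Complex.analyticAt_iff_eventually_differentiableAt]
  filter_upwards [eventually_nhds_chartAt_symm_iff.2 h,
    (chartAt ℂ p).open_target.mem_nhds (mem_chart_target ℂ p)] with z hz hzt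
  exact differentiableAt_of_mdifferentiableAt hzt hz

theorem IsMeromorphic.eventually_mdifferentiableAt {f : X → ℂ} (hf : IsMeromorphic f) (p : X) :
    ∀ᶠ q in 𝓝[≠] p, MDifferentiableAt 𝓘(ℂ) 𝓘(ℂ) f q := by
  rw [← eventually_chartAt_symm_iff]
  filter_upwards [(hf p).eventually_analyticAt, nhdsWithin_le_nhds
    ((chartAt ℂ p).open_target.mem_nhds (mem_chart_target ℂ p))] with z hz hzt
  refine mdifferentiableAt_of_analyticAt ((chartAt ℂ p).map_target hzt) ?_
  rw [(chartAt ℂ p).right_inv hzt]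
  exact hz.differentiableAt

theorem IsMeromorphic.limitFunction_eventuallyEq {f : X → ℂ} (hf : IsMeromorphic f) (p : X) :
    limitFunction f =ᶠ[𝓝[≠] p] f := by
  filter_upwards [hf.eventually_mdifferentiableAt p] with q hq
  exact limitFunction_eq_of_tendsto (hq.continuousAt.tendsto.mono_left nhdsWithin_le_nhds)

theorem IsMeromorphic.mdifferentiableAt_limitFunction {f : X → ℂ} (hf : IsMeromorphic f) {p : X}
    (h : 0 ≤ ordAt f p) : MDifferentiableAt 𝓘(ℂ) 𝓘(ℂ) (limitFunction f) p := by
  refine mdifferentiableAt_of_analyticAt (p := p) (mem_chart_source ℂ p) ?_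
  set F := f ∘ (chartAt ℂ p).symm
  have hN : AnalyticAt ℂ (toMeromorphicNFAt F (chartAt ℂ p p)) (chartAt ℂ p p) :=
    (hf p).meromorphicOrderAt_nonneg_iff_analyticAt_toMeromorphicNFAt.1 h
  have hlim : Tendsto F (𝓝[≠] (chartAt ℂ p p))
      (𝓝 (toMeromorphicNFAt F (chartAt ℂ p p) (chartAt ℂ p p))) :=
    (hN.continuousAt.tendsto.mono_left nhdsWithin_le_nhds).congr'
      (hf p).eq_nhdsNE_toMeromorphicNFAt.symm
  refine hN.differentiableAt.congr_of_eventuallyEq ?_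
  refine eventuallyEq_nhds_of_eventuallyEq_nhdsNE ?_ ?_
  · have h1 : limitFunction f ∘ (chartAt ℂ p).symm =ᶠ[𝓝[≠] (chartAt ℂ p p)] F :=
      eventually_chartAt_symm_iff.2 (hf.limitFunction_eventuallyEq p)
    exact h1.trans (hf p).eq_nhdsNE_toMeromorphicNFAt
  · rw [Function.comp_apply, (chartAt ℂ p).left_inv (mem_chart_source ℂ p)]
    exact limitFunction_eq_of_tendsto (tendsto_comp_chartAt_symm_iff.1 hlim)

/-- The maximum principle applies once removable singularities are filled in. The conclusion
concerns punctured neighbourhoods only, since the value of a meromorphic function at an isolated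
point is arbitrary. -/
theorem IsMeromorphic.exists_eventually_eq_const [CompactSpace X] [PreconnectedSpace X]
    {f : X → ℂ} (hf : IsMeromorphic f) (h : ∀ p, 0 ≤ ordAt f p) :
    ∃ c, ∀ p, ∀ᶠ q in 𝓝[≠] p, f q = c := by
  have : IsManifold 𝓘(ℂ) 1 X := IsManifold.of_le (n := ω) le_top
  have hd : MDifferentiable 𝓘(ℂ) 𝓘(ℂ) (limitFunction f) :=
    fun p => hf.mdifferentiableAt_limitFunction (h p)
  obtain ⟨c, hc⟩ := hd.exists_eq_const_of_compactSpace
  refine ⟨c, fun p => ?_⟩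
  filter_upwards [hf.limitFunction_eventuallyEq p] with q hq
  rw [← hq, hc]
  rfl

end Charts
end RiemannSurface

namespace RiemannSurface

/-! ### Differentials in charts. -/

section Tangent

variable {X : Type*} [TopologicalSpace X] [ChartedSpace ℂ X]

theorem tangent_apply_eq {q : X} (L : TangentSpace 𝓘(ℂ) q →L[ℂ] ℂ) (v : TangentSpace 𝓘(ℂ) q) :
    L v = (show ℂ from v) * L (show TangentSpace 𝓘(ℂ) q from (1 : ℂ)) := by
  have h : v = (show ℂ from v) • (show TangentSpace 𝓘(ℂ) q from (1 : ℂ)) := by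
    change (show ℂ from v) = (show ℂ from v) * 1
    rw [mul_one]
  conv_lhs => rw [h, map_smul, smul_eq_mul]

variable [IsManifold 𝓘(ℂ) ω X]

theorem deriv_comp_chartAt_symm {f : X → ℂ} {p : X} {z : ℂ} (hz : z ∈ (chartAt ℂ p).target)
    (h : MDifferentiableAt 𝓘(ℂ) 𝓘(ℂ) f ((chartAt ℂ p).symm z)) :
    deriv (f ∘ (chartAt ℂ p).symm) z =
      mfderiv 𝓘(ℂ) 𝓘(ℂ) f ((chartAt ℂ p).symm z)
        (mfderiv 𝓘(ℂ) 𝓘(ℂ) (chartAt ℂ p).symm z (1 : ℂ)) := by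
  have h1 : MDifferentiableAt 𝓘(ℂ) 𝓘(ℂ) (chartAt ℂ p).symm z :=
    mdifferentiableAt_atlas_symm (chart_mem_atlas ℂ p) hz
  have h2 := mfderiv_comp z h h1
  rw [mfderiv_eq_fderiv] at h2
  rw [← fderiv_apply_one_eq_deriv, h2]
  rfl

theorem mfderiv_chartAt_symm_ne_zero {p : X} {z : ℂ} (hz : z ∈ (chartAt ℂ p).target) :
    mfderiv 𝓘(ℂ) 𝓘(ℂ) (chartAt ℂ p).symm z (1 : ℂ) ≠ 0 := by
  have h1 : MDifferentiableAt 𝓘(ℂ) 𝓘(ℂ) (chartAt ℂ p) ((chartAt ℂ p).symm z) :=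
    mdifferentiableAt_atlas (chart_mem_atlas ℂ p) ((chartAt ℂ p).map_target hz)
  have h2 : deriv (chartAt ℂ p ∘ (chartAt ℂ p).symm) z = 1 := by
    have : chartAt ℂ p ∘ (chartAt ℂ p).symm =ᶠ[𝓝 z] id := by
      filter_upwards [(chartAt ℂ p).open_target.mem_nhds hz] with w hw
      exact (chartAt ℂ p).right_inv hw
    rw [this.deriv_eq, deriv_id]
  intro h0
  rw [deriv_comp_chartAt_symm hz h1, h0, map_zero] at h2
  exact zero_ne_one (α := ℂ) h2

theorem mfderiv_ne_zero_iff {f : X → ℂ} {p : X} (h : MDifferentiableAt 𝓘(ℂ) 𝓘(ℂ) f p) :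
    mfderiv 𝓘(ℂ) 𝓘(ℂ) f p ≠ 0 ↔ deriv (f ∘ (chartAt ℂ p).symm) (chartAt ℂ p p) ≠ 0 := by
  have hp := (chartAt ℂ p).left_inv (mem_chart_source ℂ p)
  have h1 := deriv_comp_chartAt_symm (mem_chart_target ℂ p)
    (by rwa [hp] : MDifferentiableAt 𝓘(ℂ) 𝓘(ℂ) f
    ((chartAt ℂ p).symm (chartAt ℂ p p)))
  have h2 := mfderiv_chartAt_symm_ne_zero (mem_chart_target ℂ p)
  rw [h1, not_iff_not]
  constructor
  · intro h0
    have : mfderiv 𝓘(ℂ) 𝓘(ℂ) f ((chartAt ℂ p).symm (chartAt ℂ p p)) = 0 := by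
      rw [hp]; exact h0
    rw [this]; rfl
  · intro h0
    have h3 : mfderiv 𝓘(ℂ) 𝓘(ℂ) f ((chartAt ℂ p).symm (chartAt ℂ p p)) = 0 := by
      have h4 := (tangent_apply_eq (mfderiv 𝓘(ℂ) 𝓘(ℂ) f
        ((chartAt ℂ p).symm (chartAt ℂ p p))) _).symm.trans h0
      ext
      exact (mul_eq_zero.1 h4).resolve_left h2
    rwa [hp] at h3

end Tangent

section Local

variable {X : Type*} [TopologicalSpace X] [ChartedSpace ℂ X]

theorem map_nhds_of_deriv_ne_zero {f : X → ℂ} {p : X}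
    (hf : AnalyticAt ℂ (f ∘ (chartAt ℂ p).symm) (chartAt ℂ p p))
    (h0 : deriv (f ∘ (chartAt ℂ p).symm) (chartAt ℂ p p) ≠ 0) : map f (𝓝 p) = 𝓝 (f p) := by
  have := hf.hasStrictDerivAt.map_nhds_eq h0
  rwa [← Filter.map_map, map_chartAt_symm_nhds, Function.comp_apply,
    (chartAt ℂ p).left_inv (mem_chart_source ℂ p)] at this

theorem ordAt_sub_eq_one {f : X → ℂ} {p : X}
    (hf : AnalyticAt ℂ (f ∘ (chartAt ℂ p).symm) (chartAt ℂ p p))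
    (h0 : deriv (f ∘ (chartAt ℂ p).symm) (chartAt ℂ p p) ≠ 0) :
    ordAt (fun q => f q - f p) p = 1 := by
  have := meromorphicOrderAt_sub_eq_one hf h0
  rw [Function.comp_apply, (chartAt ℂ p).left_inv (mem_chart_source ℂ p)] at this
  exact this

end Local

/-! ### The affine curve: local coordinates and orders where `x` is finite. -/

namespace HyperellipticModel

section Finite

variable {g : ℕ} {X : Type*} [TopologicalSpace X] [ChartedSpace ℂ X]
  (H : HyperellipticModel g X)

/-- The polynomial `∏ (t - e i)`. -/
noncomputable def poly (t : ℂ) : ℂ := ∏ i, (t - H.e i)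

/-- The points at which `x` is finite. -/
def IsFinite (p : X) : Prop := 0 ≤ ordAt H.x p

theorem poly_eq_mul (i : Fin H.r) (t : ℂ) :
    H.poly t = (t - H.e i) * ∏ j ∈ Finset.univ.erase i, (t - H.e j) :=
  (Finset.mul_prod_erase _ _ (Finset.mem_univ i)).symm

theorem poly_eq_zero_iff {t : ℂ} : H.poly t = 0 ↔ ∃ i, t = H.e i := by
  simp [poly, Finset.prod_eq_zero_iff, sub_eq_zero]

theorem analyticAt_poly (t : ℂ) : AnalyticAt ℂ H.poly t :=
  Finset.analyticAt_fun_prod _ fun _ _ => analyticAt_id.sub analyticAt_const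

theorem deriv_poly_ne_zero (i : Fin H.r) : deriv H.poly (H.e i) ≠ 0 := by
  have h1 : AnalyticAt ℂ (fun t => ∏ j ∈ Finset.univ.erase i, (t - H.e j)) (H.e i) :=
    Finset.analyticAt_fun_prod _ fun _ _ => analyticAt_id.sub analyticAt_const
  have h2 := ((hasDerivAt_id (H.e i)).sub_const (H.e i)).mul h1.differentiableAt.hasDerivAt
  have h3 : H.poly = (fun t => id t - H.e i) * fun t => ∏ j ∈ Finset.univ.erase i, (t - H.e j) :=
    funext fun t => H.poly_eq_mul i t
  rw [h3, h2.deriv]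
  simp only [id, sub_self, zero_mul, add_zero, one_mul]
  refine Finset.prod_ne_zero_iff.2 fun j hj => sub_ne_zero.2 fun h => ?_
  exact (Finset.ne_of_mem_erase hj) (H.e_injective h).symm

theorem sq_y {p : X} (hp : H.IsFinite p) : H.y p ^ 2 = H.poly (H.x p) := H.bijOn.mapsTo hp

theorem eq_of_x_eq_of_y_eq {p q : X} (hp : H.IsFinite p) (hq : H.IsFinite q) (hx : H.x p = H.x q)
    (hy : H.y p = H.y q) : p = q := H.bijOn.injOn hp hq (Prod.ext hx hy)

theorem exists_point {a b : ℂ} (h : b ^ 2 = H.poly a) :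
    ∃ p, H.IsFinite p ∧ H.x p = a ∧ H.y p = b := by
  obtain ⟨p, hp, hpe⟩ := H.bijOn.surjOn (show (a, b) ∈ {ab : ℂ × ℂ | _} from h)
  exact ⟨p, hp, congrArg Prod.fst hpe, congrArg Prod.snd hpe⟩

theorem y_eq_zero_iff {p : X} (hp : H.IsFinite p) : H.y p = 0 ↔ ∃ i, H.x p = H.e i := by
  rw [← H.poly_eq_zero_iff, ← H.sq_y hp, sq_eq_zero_iff]

theorem continuousAt_x {p : X} (hp : H.IsFinite p) : ContinuousAt H.x p :=
  (H.holomorphic_x p hp).continuousAt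

theorem continuousAt_y {p : X} (hp : H.IsFinite p) : ContinuousAt H.y p :=
  (H.holomorphic_y p hp).continuousAt

theorem ordAt_y_of_ne_zero {p : X} (hp : H.IsFinite p) (hy : H.y p ≠ 0) : ordAt H.y p = 0 :=
  H.isMeromorphic_y.tendsto_ne_zero_iff.1
    ⟨_, hy, (H.continuousAt_y hp).tendsto.mono_left nhdsWithin_le_nhds⟩

theorem ordAt_x_sub_of_ne {p : X} (hp : H.IsFinite p) {c : ℂ} (hc : H.x p ≠ c) :
    ordAt (fun q => H.x q - c) p = 0 :=
  (H.isMeromorphic_x.sub_const c).tendsto_ne_zero_iff.1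
    ⟨_, sub_ne_zero.2 hc, ((H.continuousAt_x hp).sub continuousAt_const).tendsto.mono_left
      nhdsWithin_le_nhds⟩

theorem ordAt_poly_comp_x (p : X) :
    ordAt (fun q => H.poly (H.x q)) p = ∑ i, ordAt (fun q => H.x q - H.e i) p :=
  ordAt_prod (f := fun i q ↦ H.x q - H.e i) (fun _ => H.isMeromorphic_x.sub_const _) p

variable [IsManifold 𝓘(ℂ) ω X]

theorem eventually_isFinite_nhdsNE (p : X) : ∀ᶠ q in 𝓝[≠] p, H.IsFinite q := by
  filter_upwards [H.isMeromorphic_x.eventually_mdifferentiableAt p] with q hq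
  exact ordAt_nonneg_of_continuousAt H.isMeromorphic_x hq.continuousAt

theorem eventually_isFinite {p : X} (hp : H.IsFinite p) : ∀ᶠ q in 𝓝 p, H.IsFinite q := by
  have := H.eventually_isFinite_nhdsNE p
  rw [eventually_nhdsWithin_iff] at this
  filter_upwards [this] with q hq
  by_cases h : q = p
  · rwa [h]
  · exact hq h

theorem analyticAt_x {p : X} (hp : H.IsFinite p) :
    AnalyticAt ℂ (H.x ∘ (chartAt ℂ p).symm) (chartAt ℂ p p) :=
  analyticAt_of_eventually_mdifferentiableAt
    ((H.eventually_isFinite hp).mono fun q hq => H.holomorphic_x q hq)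

theorem analyticAt_y {p : X} (hp : H.IsFinite p) :
    AnalyticAt ℂ (H.y ∘ (chartAt ℂ p).symm) (chartAt ℂ p p) :=
  analyticAt_of_eventually_mdifferentiableAt
    ((H.eventually_isFinite hp).mono fun q hq => H.holomorphic_y q hq)

theorem deriv_ne_zero_or {p : X} (hp : H.IsFinite p) :
    deriv (H.x ∘ (chartAt ℂ p).symm) (chartAt ℂ p p) ≠ 0 ∨
      deriv (H.y ∘ (chartAt ℂ p).symm) (chartAt ℂ p p) ≠ 0 := by
  rw [← mfderiv_ne_zero_iff (H.holomorphic_x p hp), ← mfderiv_ne_zero_iff (H.holomorphic_y p hp)]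
  exact H.immersion p hp

/-- The equation of the curve, differentiated in a chart. With the immersion condition it makes `x`
a local coordinate where `y ≠ 0` and, the roots being simple, `y` one where `y = 0`. -/
theorem two_mul_y_mul_deriv {p : X} (hp : H.IsFinite p) :
    2 * H.y p * deriv (H.y ∘ (chartAt ℂ p).symm) (chartAt ℂ p p) =
      deriv H.poly (H.x p) * deriv (H.x ∘ (chartAt ℂ p).symm) (chartAt ℂ p p) := by
  have hl := (chartAt ℂ p).left_inv (mem_chart_source ℂ p)
  have hx := (H.analyticAt_x hp).differentiableAt.hasDerivAt
  have hy := (H.analyticAt_y hp).differentiableAt.hasDerivAt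
  have hF := (H.analyticAt_poly ((H.x ∘ (chartAt ℂ p).symm)
    (chartAt ℂ p p))).differentiableAt.hasDerivAt
  have h1 := hF.comp _ hx
  have h2 := hy.pow 2
  have h3 : (H.y ∘ (chartAt ℂ p).symm) ^ 2 =ᶠ[𝓝 (chartAt ℂ p p)]
      H.poly ∘ (H.x ∘ (chartAt ℂ p).symm) :=
    (eventually_nhds_chartAt_symm_iff.2 (H.eventually_isFinite hp)).mono fun z hz => H.sq_y hz
  have h4 := h2.unique (h1.congr_of_eventuallyEq h3)
  simpa [hl] using h4

theorem deriv_x_ne_zero {p : X} (hp : H.IsFinite p) (hy : H.y p ≠ 0) :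
    deriv (H.x ∘ (chartAt ℂ p).symm) (chartAt ℂ p p) ≠ 0 := by
  intro h0
  have h1 := H.two_mul_y_mul_deriv hp
  rw [h0, mul_zero] at h1
  exact (H.deriv_ne_zero_or hp).resolve_left (not_not.2 h0)
    ((mul_eq_zero.1 h1).resolve_left (mul_ne_zero two_ne_zero hy))

theorem deriv_y_ne_zero {p : X} (hp : H.IsFinite p) (hy : H.y p = 0) :
    deriv (H.y ∘ (chartAt ℂ p).symm) (chartAt ℂ p p) ≠ 0 := by
  obtain ⟨i, hi⟩ := (H.y_eq_zero_iff hp).1 hy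
  refine (H.deriv_ne_zero_or hp).resolve_left (not_not.2 ?_)
  have h1 := H.two_mul_y_mul_deriv hp
  rw [hy, mul_zero, zero_mul, hi] at h1
  exact (mul_eq_zero.1 h1.symm).resolve_left (H.deriv_poly_ne_zero i)

theorem map_x_nhds {p : X} (hp : H.IsFinite p) (hy : H.y p ≠ 0) :
    map H.x (𝓝 p) = 𝓝 (H.x p) :=
  map_nhds_of_deriv_ne_zero (H.analyticAt_x hp) (H.deriv_x_ne_zero hp hy)

theorem map_y_nhds {p : X} (hp : H.IsFinite p) (hy : H.y p = 0) :
    map H.y (𝓝 p) = 𝓝 (H.y p) :=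
  map_nhds_of_deriv_ne_zero (H.analyticAt_y hp) (H.deriv_y_ne_zero hp hy)

theorem ordAt_x_sub_of_y_ne_zero {p : X} (hp : H.IsFinite p) (hy : H.y p ≠ 0) :
    ordAt (fun q => H.x q - H.x p) p = 1 :=
  ordAt_sub_eq_one (H.analyticAt_x hp) (H.deriv_x_ne_zero hp hy)

theorem ordAt_y_of_eq_zero {p : X} (hp : H.IsFinite p) (hy : H.y p = 0) : ordAt H.y p = 1 := by
  have := ordAt_sub_eq_one (H.analyticAt_y hp) (H.deriv_y_ne_zero hp hy)
  simpa [hy] using this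

/-- Orders in `y² = ∏ (x - e i)`. This also holds at a pole of `x`, because the equation is valid on
a punctured neighbourhood. -/
theorem two_mul_ordAt_y (p : X) :
    (2 : ℕ) * ordAt H.y p = ∑ i, ordAt (fun q => H.x q - H.e i) p := by
  rw [← ordAt_pow H.isMeromorphic_y, ← H.ordAt_poly_comp_x]
  exact ordAt_congr ((H.eventually_isFinite_nhdsNE p).mono fun q hq => H.sq_y hq)

theorem ordAt_x_sub_e {p : X} (hp : H.IsFinite p) {i : Fin H.r} (hi : H.x p = H.e i) :
    ordAt (fun q => H.x q - H.e i) p = 2 := by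
  have h1 := H.two_mul_ordAt_y p
  rw [H.ordAt_y_of_eq_zero hp ((H.y_eq_zero_iff hp).2 ⟨i, hi⟩), Finset.sum_eq_single i] at h1
  · rw [← h1]; rfl
  · intro j _ hj
    exact H.ordAt_x_sub_of_ne hp (fun h => hj (H.e_injective (h.symm.trans hi)))
  · simp

end Finite
end HyperellipticModel
end RiemannSurface

/-! ### The points at infinity. -/

namespace RiemannSurface

theorem deriv_ne_zero_of_injOn_nhds {X : Type*} [TopologicalSpace X] [ChartedSpace ℂ X]
    {f : X → ℂ} {p : X} (hf : AnalyticAt ℂ (f ∘ (chartAt ℂ p).symm) (chartAt ℂ p p))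
    {s : Set X} (hs : s ∈ 𝓝 p) (hinj : InjOn f s) :
    deriv (f ∘ (chartAt ℂ p).symm) (chartAt ℂ p p) ≠ 0 := by
  refine deriv_ne_zero_of_injOn hf (s := (chartAt ℂ p).target ∩ (chartAt ℂ p).symm ⁻¹' s)
    (inter_mem ((chartAt ℂ p).open_target.mem_nhds (mem_chart_target ℂ p))
      (eventually_nhds_chartAt_symm_iff.2 hs)) ?_
  intro z hz w hw hzw
  exact (chartAt ℂ p).symm.injOn hz.1 hw.1 (hinj hz.2 hw.2 hzw)

namespace HyperellipticModel

section Infinity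

variable {g : ℕ} {X : Type*} [TopologicalSpace X] [ChartedSpace ℂ X]
  (H : HyperellipticModel g X)

/-- The polynomial `u ^ (2 * g + 2) * ∏ (1 / u - e i)`: the curve is `v² = H.reversePoly u` in the
coordinates `u = 1 / x` and `v = y / x ^ (g + 1)`. -/
noncomputable def reversePoly (u : ℂ) : ℂ := u ^ (2 * g + 2 - H.r) * ∏ i, (1 - H.e i * u)

theorem reversePoly_eq {u : ℂ} (hu : u ≠ 0) : H.reversePoly u = u ^ (2 * g + 2) * H.poly u⁻¹ := by
  have h1 : ∏ i, (1 - H.e i * u) = u ^ H.r * H.poly u⁻¹ := by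
    rw [poly, ← Fin.prod_const, ← Finset.prod_mul_distrib]
    refine Finset.prod_congr rfl fun i _ => ?_
    field_simp
  rw [reversePoly, h1, ← mul_assoc, ← pow_add]
  rw [Nat.sub_add_cancel (by rcases H.r_eq with h | h <;> omega)]

theorem analyticAt_reversePoly (u : ℂ) : AnalyticAt ℂ H.reversePoly u :=
  (analyticAt_id.pow _).mul (Finset.analyticAt_fun_prod _ fun _ _ =>
    analyticAt_const.sub (analyticAt_const.mul analyticAt_id))

theorem reversePoly_zero_of_even (h : H.r = 2 * g + 2) : H.reversePoly 0 = 1 := by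
  simp [reversePoly, h]

theorem reversePoly_zero_of_odd (h : H.r = 2 * g + 1) : H.reversePoly 0 = 0 := by
  simp [reversePoly, h]

theorem deriv_reversePoly_ne_zero (h : H.r = 2 * g + 1) : deriv H.reversePoly 0 ≠ 0 := by
  have h1 : AnalyticAt ℂ (fun u => ∏ i, (1 - H.e i * u)) 0 :=
    Finset.analyticAt_fun_prod _ fun _ _ =>
      analyticAt_const.sub (analyticAt_const.mul analyticAt_id)
  have h2 := (hasDerivAt_id (0 : ℂ)).mul h1.differentiableAt.hasDerivAt
  have h3 : H.reversePoly = id * fun u => ∏ i, (1 - H.e i * u) := by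
    funext u
    have : 2 * g + 2 - H.r = 1 := by omega
    simp [reversePoly, this]
  rw [h3, h2.deriv]
  simp

/-- The function `1 / x`, with its removable singularities removed. -/
noncomputable def u : X → ℂ := limitFunction fun q => (H.x q)⁻¹

/-- The function `y / x ^ (g + 1)`, with its removable singularities removed. -/
noncomputable def v : X → ℂ := limitFunction fun q => H.y q * (H.x q)⁻¹ ^ (g + 1)

/-- A local coordinate at the poles of `x`. -/
noncomputable def w : X → ℂ := if H.r = 2 * g + 1 then H.v else H.u

/-- The finite points at which `x` does not vanish. -/
def IsRegular (q : X) : Prop := H.IsFinite q ∧ H.x q ≠ 0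

variable {H}

theorem isMeromorphic_y_mul_inv_pow : IsMeromorphic fun q => H.y q * (H.x q)⁻¹ ^ (g + 1) :=
  H.isMeromorphic_y.mul (H.isMeromorphic_x.inv.pow _)

theorem IsRegular.continuousAt_inv {q : X} (hq : H.IsRegular q) :
    ContinuousAt (fun q => (H.x q)⁻¹) q := (H.continuousAt_x hq.1).inv₀ hq.2

theorem IsRegular.continuousAt_mul {q : X} (hq : H.IsRegular q) :
    ContinuousAt (fun q => H.y q * (H.x q)⁻¹ ^ (g + 1)) q :=
  (H.continuousAt_y hq.1).mul (hq.continuousAt_inv.pow _)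

theorem IsRegular.u_eq {q : X} (hq : H.IsRegular q) : H.u q = (H.x q)⁻¹ :=
  limitFunction_eq_of_tendsto (hq.continuousAt_inv.tendsto.mono_left nhdsWithin_le_nhds)

theorem IsRegular.v_eq {q : X} (hq : H.IsRegular q) : H.v q = H.y q * (H.x q)⁻¹ ^ (g + 1) :=
  limitFunction_eq_of_tendsto (hq.continuousAt_mul.tendsto.mono_left nhdsWithin_le_nhds)

theorem IsRegular.u_ne_zero {q : X} (hq : H.IsRegular q) : H.u q ≠ 0 := by
  rw [hq.u_eq]
  exact inv_ne_zero hq.2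

theorem IsRegular.sq_v {q : X} (hq : H.IsRegular q) : H.v q ^ 2 = H.reversePoly (H.u q) := by
  rw [H.reversePoly_eq hq.u_ne_zero, hq.u_eq, hq.v_eq, inv_inv, ← H.sq_y hq.1]
  ring

theorem IsRegular.eq_of_eq {q q' : X} (hq : H.IsRegular q) (hq' : H.IsRegular q')
    (hu : H.u q = H.u q') (hv : H.v q = H.v q') : q = q' := by
  have h1 : H.x q = H.x q' := by
    rw [hq.u_eq, hq'.u_eq] at hu
    exact inv_injective hu
  refine H.eq_of_x_eq_of_y_eq hq.1 hq'.1 h1 ?_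
  rw [hq.v_eq, hq'.v_eq, h1] at hv
  exact mul_right_cancel₀ (pow_ne_zero _ (inv_ne_zero hq'.2)) hv

theorem tendsto_x_of_pole {p : X} (hp : ¬ H.IsFinite p) :
    Tendsto H.x (𝓝[≠] p) (Bornology.cobounded ℂ) :=
  H.isMeromorphic_x.tendsto_cobounded_iff.2 (not_le.1 hp)

variable (H) in
/-- Near a point `(0, c)` of the curve at infinity, the points are determined by `w`. -/
theorem exists_nhds_eq_of_w_eq {c : ℂ} (hc : c ^ 2 = H.reversePoly 0) :
    ∃ s ∈ 𝓝 (0 : ℂ), ∃ t ∈ 𝓝 c, ∀ q q' : X, H.u q ∈ s → H.u q' ∈ s → H.v q ∈ t → H.v q' ∈ t →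
      H.v q ^ 2 = H.reversePoly (H.u q) → H.v q' ^ 2 = H.reversePoly (H.u q') →
      H.w q = H.w q' → H.u q = H.u q' ∧ H.v q = H.v q' := by
  by_cases h : H.r = 2 * g + 1
  -- Odd degree: `reversePoly` has a simple zero at 0, so `v` determines `v² = reversePoly u` and
  -- hence `u`.
  · obtain ⟨s, hs, hinj⟩ := exists_injOn_of_deriv_ne_zero (H.analyticAt_reversePoly 0)
      (H.deriv_reversePoly_ne_zero h)
    refine ⟨s, hs, univ, univ_mem, fun q q' hq hq' _ _ hv hv' hw => ?_⟩
    simp only [w, h, if_true] at hw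
    refine ⟨hinj hq hq' ?_, hw⟩
    rw [← hv, ← hv', hw]
  -- Even degree: `u` determines `v` up to sign, and the ball around `c` of radius `‖c‖` never
  -- contains both signs.
  · have hc0 : c ≠ 0 := by
      rintro rfl
      rw [H.reversePoly_zero_of_even (H.r_eq.resolve_left h)] at hc
      simp at hc
    refine ⟨univ, univ_mem, Metric.ball c ‖c‖, Metric.ball_mem_nhds c (norm_pos_iff.2 hc0),
      fun q q' _ _ hq hq' hv hv' hw => ?_⟩
    simp only [w, h, if_false] at hw
    refine ⟨hw, ?_⟩
    rw [hw, ← hv'] at hv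
    refine (sq_eq_sq_iff_eq_or_eq_neg.1 hv).resolve_right fun h1 => ?_
    rw [mem_ball_iff_norm] at hq hq'
    have h2 : ‖2 * c‖ ≤ ‖H.v q - c‖ + ‖H.v q' - c‖ := by
      refine le_trans (le_of_eq ?_) (norm_add_le _ _)
      rw [h1, ← norm_neg]
      congr 1
      ring
    rw [norm_mul, Complex.norm_ofNat] at h2
    linarith

-- Choose the root `s z` closer to `c` than to `-c`; then `|s - c|² ≤ |s - c| |s + c| = |reversePoly
-- z - reversePoly 0|`. This covers `c = 0`, where no analytic root need exist.
variable (H) in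
theorem exists_sqrt_reversePoly {c : ℂ} (hc : c ^ 2 = H.reversePoly 0) :
    ∃ s : ℂ → ℂ, (∀ z, s z ^ 2 = H.reversePoly z) ∧ Tendsto s (𝓝 0) (𝓝 c) := by
  have h1 : ∀ z, ∃ a : ℂ, a ^ 2 = H.reversePoly z ∧ ‖a - c‖ ≤ ‖a + c‖ := by
    intro z
    obtain ⟨a, ha⟩ := IsAlgClosed.exists_pow_nat_eq (H.reversePoly z) two_pos
    rcases le_total ‖a - c‖ ‖a + c‖ with h | h
    · exact ⟨a, ha, h⟩
    · refine ⟨-a, by rw [neg_sq, ha], ?_⟩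
      rwa [← norm_neg, ← norm_neg (-a + c), show -(-a - c) = a + c by ring,
        show -(-a + c) = a - c by ring]
  choose s hs hsc using h1
  refine ⟨s, hs, ?_⟩
  rw [tendsto_iff_norm_sub_tendsto_zero]
  have h2 : Tendsto (fun z => √‖H.reversePoly z - H.reversePoly 0‖) (𝓝 0) (𝓝 0) := by
    have := (tendsto_iff_norm_sub_tendsto_zero.1
      (H.analyticAt_reversePoly 0).continuousAt.tendsto).sqrt
    rwa [Real.sqrt_zero] at this
  refine squeeze_zero (fun _ => norm_nonneg _) (fun z => Real.le_sqrt_of_sq_le ?_) h2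
  rw [← hs z, ← hc, sq_sub_sq, norm_mul, sq, mul_comm ‖s z + c‖]
  exact mul_le_mul_of_nonneg_left (hsc z) (norm_nonneg _)

theorem ordAt_inv_x_pos {p : X} (hp : ¬ H.IsFinite p) : 0 < ordAt (fun q => (H.x q)⁻¹) p := by
  rw [← H.isMeromorphic_x.inv.tendsto_zero_iff]
  exact tendsto_inv₀_cobounded.comp (tendsto_x_of_pole hp)

theorem ordAt_x_sub_of_pole {p : X} (hp : ¬ H.IsFinite p) (c : ℂ) :
    ordAt (fun q => H.x q - c) p = ordAt H.x p := by
  have h1 : ordAt (fun q => H.x q - c) p = meromorphicOrderAt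
      (H.x ∘ (chartAt ℂ p).symm + fun _ => -c) (chartAt ℂ p p) := by
    simp only [sub_eq_add_neg]
    rfl
  rw [h1]
  refine meromorphicOrderAt_add_eq_left_of_lt (MeromorphicAt.const _ _) ?_
  exact (not_le.1 hp).trans_le analyticAt_const.meromorphicOrderAt_nonneg

theorem u_eq_zero {p : X} (hp : ¬ H.IsFinite p) : H.u p = 0 :=
  limitFunction_eq_of_tendsto (H.isMeromorphic_x.inv.tendsto_zero_iff.2 (ordAt_inv_x_pos hp))

variable [IsManifold 𝓘(ℂ) ω X] {p : X}

theorem eventually_isRegular (hp : ¬ H.IsFinite p) : ∀ᶠ q in 𝓝[≠] p, H.IsRegular q := by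
  filter_upwards [H.eventually_isFinite_nhdsNE p, H.isMeromorphic_x.eventually_ne_zero
    (p := p) (ne_top_of_lt (not_le.1 hp))] with q h1 h2 using ⟨h1, h2⟩

theorem eventually_eq_or_isRegular (hp : ¬ H.IsFinite p) :
    ∀ᶠ q in 𝓝 p, q = p ∨ H.IsRegular q := by
  filter_upwards [eventually_nhdsWithin_iff.1 (eventually_isRegular hp)] with q hq
  exact (em (q = p)).imp_right hq

/-- The square of this function equals `reversePoly (1 / x)` nearby and so has a finite limit. -/
theorem ordAt_y_mul_inv_pow_nonneg (hp : ¬ H.IsFinite p) :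
    0 ≤ ordAt (fun q => H.y q * (H.x q)⁻¹ ^ (g + 1)) p := by
  have h1 : 0 ≤ ordAt (fun q => (H.y q * (H.x q)⁻¹ ^ (g + 1)) ^ 2) p := by
    rw [← (isMeromorphic_y_mul_inv_pow.pow 2).tendsto_nhds_iff]
    refine ⟨H.reversePoly 0, ?_⟩
    have h2 := ((H.analyticAt_reversePoly 0).continuousAt.tendsto).comp
      (H.isMeromorphic_x.inv.tendsto_zero_iff.2 (ordAt_inv_x_pos hp))
    refine h2.congr' ?_
    filter_upwards [eventually_isRegular hp] with q hq
    rw [← hq.v_eq, hq.sq_v, hq.u_eq]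
    rfl
  rw [ordAt_pow isMeromorphic_y_mul_inv_pow] at h1
  by_contra h
  rw [not_le] at h
  obtain ⟨m, hm⟩ := WithTop.ne_top_iff_exists.1 (ne_top_of_lt h)
  rw [← hm] at h h1
  have h3 : m < 0 := by exact_mod_cast h
  have h4 : ((0 : ℤ) : WithTop ℤ) ≤ ((2 * m : ℤ) : WithTop ℤ) := h1
  rw [WithTop.coe_le_coe] at h4
  omega

theorem eventually_mdifferentiableAt_u (hp : ¬ H.IsFinite p) :
    ∀ᶠ q in 𝓝 p, MDifferentiableAt 𝓘(ℂ) 𝓘(ℂ) H.u q := by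
  filter_upwards [eventually_eq_or_isRegular hp] with q hq
  refine H.isMeromorphic_x.inv.mdifferentiableAt_limitFunction ?_
  rcases hq with rfl | hq
  · exact (ordAt_inv_x_pos hp).le
  · exact ordAt_nonneg_of_continuousAt H.isMeromorphic_x.inv hq.continuousAt_inv

theorem eventually_mdifferentiableAt_v (hp : ¬ H.IsFinite p) :
    ∀ᶠ q in 𝓝 p, MDifferentiableAt 𝓘(ℂ) 𝓘(ℂ) H.v q := by
  filter_upwards [eventually_eq_or_isRegular hp] with q hq
  refine isMeromorphic_y_mul_inv_pow.mdifferentiableAt_limitFunction ?_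
  rcases hq with rfl | hq
  · exact ordAt_y_mul_inv_pow_nonneg hp
  · exact ordAt_nonneg_of_continuousAt isMeromorphic_y_mul_inv_pow hq.continuousAt_mul

theorem continuousAt_u (hp : ¬ H.IsFinite p) : ContinuousAt H.u p :=
  (eventually_mdifferentiableAt_u hp).self_of_nhds.continuousAt

theorem continuousAt_v (hp : ¬ H.IsFinite p) : ContinuousAt H.v p :=
  (eventually_mdifferentiableAt_v hp).self_of_nhds.continuousAt

theorem analyticAt_w (hp : ¬ H.IsFinite p) :
    AnalyticAt ℂ (H.w ∘ (chartAt ℂ p).symm) (chartAt ℂ p p) := by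
  apply analyticAt_of_eventually_mdifferentiableAt
  unfold w
  split_ifs
  exacts [eventually_mdifferentiableAt_v hp, eventually_mdifferentiableAt_u hp]

theorem sq_v_of_pole (hp : ¬ H.IsFinite p) : H.v p ^ 2 = H.reversePoly 0 := by
  have h1 : Tendsto (fun q => H.v q ^ 2) (𝓝[≠] p) (𝓝 (H.v p ^ 2)) :=
    ((continuousAt_v hp).tendsto.pow 2).mono_left nhdsWithin_le_nhds
  have h2 : Tendsto (fun q => H.reversePoly (H.u q)) (𝓝[≠] p) (𝓝 (H.reversePoly 0)) := by
    have := (H.analyticAt_reversePoly (H.u p)).continuousAt.tendsto.comp (continuousAt_u hp).tendsto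
    rw [u_eq_zero hp] at this
    exact this.mono_left nhdsWithin_le_nhds
  refine tendsto_nhds_unique h1 (h2.congr' ?_)
  filter_upwards [eventually_isRegular hp] with q hq using hq.sq_v.symm

theorem w_eq_zero (hp : ¬ H.IsFinite p) : H.w p = 0 := by
  unfold w
  split_ifs with h
  · have := sq_v_of_pole hp
    rwa [H.reversePoly_zero_of_odd h, sq_eq_zero_iff] at this
  · exact u_eq_zero hp

theorem eventually_sq_v (hp : ¬ H.IsFinite p) :
    ∀ᶠ q in 𝓝 p, H.v q ^ 2 = H.reversePoly (H.u q) := by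
  filter_upwards [eventually_eq_or_isRegular hp] with q hq
  rcases hq with rfl | hq
  · rw [sq_v_of_pole hp, u_eq_zero hp]
  · exact hq.sq_v

theorem exists_nhds_eq_of_w_eq_of_pole {p p' : X} (hp : ¬ H.IsFinite p) (hp' : ¬ H.IsFinite p')
    (hv : H.v p = H.v p') : ∃ s ∈ 𝓝 p, ∃ s' ∈ 𝓝 p', ∀ q ∈ s, ∀ q' ∈ s',
      H.w q = H.w q' → H.u q = H.u q' ∧ H.v q = H.v q' := by
  obtain ⟨s, hs, t, ht, h⟩ := H.exists_nhds_eq_of_w_eq (sq_v_of_pole hp)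
  refine ⟨_, (eventually_sq_v hp).and (((continuousAt_u hp).eventually
    (by rwa [u_eq_zero hp])).and ((continuousAt_v hp).eventually ht)), _, (eventually_sq_v hp').and
    (((continuousAt_u hp').eventually (by rwa [u_eq_zero hp'])).and
      ((continuousAt_v hp').eventually (by rwa [← hv]))), ?_⟩
  rintro q ⟨h1, h2, h3⟩ q' ⟨h1', h2', h3'⟩ hw
  exact h q q' h2 h2' h3 h3' h1 h1' hw

/-- The model says nothing directly about the complex structure at a pole, so the derivative is
controlled through injectivity: `w` determines `(u, v)`, which determines a regular point, and `p`
is the only nearby point with `u = 0`. -/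
theorem deriv_w_ne_zero (hp : ¬ H.IsFinite p) :
    deriv (H.w ∘ (chartAt ℂ p).symm) (chartAt ℂ p p) ≠ 0 := by
  obtain ⟨s, hs, s', hs', h⟩ := exists_nhds_eq_of_w_eq_of_pole hp hp rfl
  refine deriv_ne_zero_of_injOn_nhds (analyticAt_w hp)
    (inter_mem (inter_mem hs hs') (eventually_eq_or_isRegular hp)) ?_
  rintro q ⟨⟨hq, -⟩, hq1⟩ q' ⟨⟨-, hq'⟩, hq1'⟩ hw
  obtain ⟨hu, hv⟩ := h q hq q' hq' hw
  rcases hq1 with rfl | hq1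
  · rcases hq1' with rfl | hq1'
    · rfl
    · exact absurd (hu.symm.trans (u_eq_zero hp)) hq1'.u_ne_zero
  · rcases hq1' with rfl | hq1'
    · exact absurd (hu.trans (u_eq_zero hp)) hq1.u_ne_zero
    · exact hq1.eq_of_eq hq1' hu hv

/-- Disjoint neighbourhoods of two such poles would both be mapped by `w` onto neighbourhoods of 0.
A common nonzero value of `w` then comes from a single regular point lying in both. -/
theorem pole_eq_of_v_eq [T2Space X] {p p' : X} (hp : ¬ H.IsFinite p) (hp' : ¬ H.IsFinite p')
    (hv : H.v p = H.v p') : p = p' := by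
  by_contra hne
  obtain ⟨s, hs, s', hs', h⟩ := exists_nhds_eq_of_w_eq_of_pole hp hp' hv
  obtain ⟨t, t', hto, hto', hpt, hpt', hd⟩ := t2_separation hne
  have hS := image_mem_map (m := H.w) (inter_mem (inter_mem hs (hto.mem_nhds hpt))
    (eventually_eq_or_isRegular hp))
  have hS' := image_mem_map (m := H.w) (inter_mem (inter_mem hs' (hto'.mem_nhds hpt'))
    (eventually_eq_or_isRegular hp'))
  rw [map_nhds_of_deriv_ne_zero (analyticAt_w hp) (deriv_w_ne_zero hp), w_eq_zero hp] at hS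
  rw [map_nhds_of_deriv_ne_zero (analyticAt_w hp') (deriv_w_ne_zero hp'), w_eq_zero hp'] at hS'
  obtain ⟨z, ⟨⟨q, ⟨⟨hq, hqt⟩, hq1⟩, hqz⟩, ⟨q', ⟨⟨hq', hqt'⟩, hq1'⟩, hqz'⟩⟩, hz⟩ :=
    (((eventually_mem_set.2 hS).and (eventually_mem_set.2 hS')).filter_mono
      nhdsWithin_le_nhds |>.and (self_mem_nhdsWithin (a := (0 : ℂ)) (s := {0}ᶜ))).exists
  obtain ⟨hu, hv⟩ := h q hq q' hq' (hqz.trans hqz'.symm)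
  have h1 : H.IsRegular q := hq1.resolve_left fun h => hz (by rw [← hqz, h, w_eq_zero hp]; rfl)
  have h1' : H.IsRegular q' :=
    hq1'.resolve_left fun h => hz (by rw [← hqz', h, w_eq_zero hp']; rfl)
  exact disjoint_left.1 hd hqt (h1.eq_of_eq h1' hu hv ▸ hqt')

-- The points over `x = 1 / z` on the branch `v = s z` accumulate somewhere as `z → 0`, by
-- compactness; the accumulation point is the required pole.
variable (H) in
theorem exists_pole [CompactSpace X] {c : ℂ} (hc : c ^ 2 = H.reversePoly 0) :
    ∃ p, ¬ H.IsFinite p ∧ H.v p = c := by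
  obtain ⟨s, hs, hsc⟩ := H.exists_sqrt_reversePoly hc
  -- The point chosen for `z = 0` is arbitrary; the limit is taken over `z ≠ 0`.
  have h1 : ∀ z : ℂ, ∃ q, z ≠ 0 → H.IsFinite q ∧ H.x q = z⁻¹ ∧ H.y q = s z * z⁻¹ ^ (g + 1) := by
    intro z
    by_cases hz : z = 0
    · obtain ⟨a, ha⟩ := IsAlgClosed.exists_pow_nat_eq (H.poly 0) two_pos
      exact ⟨(H.exists_point ha).choose, fun h => absurd hz h⟩
    · obtain ⟨q, hq⟩ := H.exists_point (a := z⁻¹) (b := s z * z⁻¹ ^ (g + 1)) (by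
        rw [mul_pow, hs, H.reversePoly_eq hz, ← pow_mul, mul_right_comm,
          show (g + 1) * 2 = 2 * g + 2 by ring, ← mul_pow, mul_inv_cancel₀ hz, one_pow, one_mul])
      exact ⟨q, fun _ => hq⟩
  choose Q hQ using h1
  set U := Ultrafilter.of (𝓝[≠] (0 : ℂ))
  have hU : (U : Filter ℂ) ≤ 𝓝[≠] 0 := Ultrafilter.of_le _
  have hU0 : ∀ᶠ z in (U : Filter ℂ), z ≠ 0 := hU self_mem_nhdsWithin
  obtain ⟨p, -, hp⟩ := isCompact_univ.ultrafilter_le_nhds (U.map Q) (by simp)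
  have hQp : Tendsto Q U (𝓝 p) := hp
  have hpole : ¬ H.IsFinite p := by
    intro hfin
    have h2 : Tendsto (fun z => H.x (Q z) * z) U (𝓝 (H.x p * 0)) :=
      ((H.continuousAt_x hfin).tendsto.comp hQp).mul (hU.trans nhdsWithin_le_nhds)
    -- At a finite point `x (Q z) * z` would tend to 0, but it is identically 1.
    have h3 : Tendsto (fun z => H.x (Q z) * z) U (𝓝 1) := by
      refine tendsto_const_nhds.congr' ?_
      filter_upwards [hU0] with z hz
      rw [(hQ z hz).2.1, inv_mul_cancel₀ hz]
    have := tendsto_nhds_unique h2 h3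
    simp at this
  refine ⟨p, hpole, ?_⟩
  refine tendsto_nhds_unique ((continuousAt_v hpole).tendsto.comp hQp)
    ((hsc.mono_left (hU.trans nhdsWithin_le_nhds)).congr' ?_)
  filter_upwards [hU0] with z hz
  obtain ⟨h2, h3, h4⟩ := hQ z hz
  have h5 : H.IsRegular (Q z) := ⟨h2, by rw [h3]; exact inv_ne_zero hz⟩
  rw [Function.comp_apply, h5.v_eq, h4, h3, inv_inv, mul_assoc, ← mul_pow, inv_mul_cancel₀ hz,
    one_pow, mul_one]

theorem ordAt_w (hp : ¬ H.IsFinite p) : ordAt H.w p = 1 := by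
  have := ordAt_sub_eq_one (analyticAt_w hp) (deriv_w_ne_zero hp)
  simpa [w_eq_zero hp] using this

theorem ordAt_x_of_even (hp : ¬ H.IsFinite p) (h : H.r = 2 * g + 2) : ordAt H.x p = -1 := by
  have h1 := ordAt_w hp
  rw [w, if_neg (by omega), u, ordAt_congr (H.isMeromorphic_x.inv.limitFunction_eventuallyEq p),
    ordAt_inv] at h1
  rw [← neg_neg (ordAt H.x p), h1]

theorem two_mul_ordAt_y_of_pole (hp : ¬ H.IsFinite p) :
    (2 : ℕ) * ordAt H.y p = H.r • ordAt H.x p := by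
  rw [H.two_mul_ordAt_y, Finset.sum_congr rfl fun i _ => ordAt_x_sub_of_pole hp (H.e i)]
  simp

theorem ordAt_x_of_odd (hp : ¬ H.IsFinite p) (h : H.r = 2 * g + 1) : ordAt H.x p = -2 := by
  have h1 := ordAt_w hp
  rw [w, if_pos h, v, ordAt_congr (isMeromorphic_y_mul_inv_pow.limitFunction_eventuallyEq p),
    ordAt_mul H.isMeromorphic_y (H.isMeromorphic_x.inv.pow _), ordAt_pow H.isMeromorphic_x.inv,
    ordAt_inv] at h1
  have h2 := two_mul_ordAt_y_of_pole hp
  obtain ⟨a, ha⟩ := WithTop.ne_top_iff_exists.1 (ne_top_of_lt (not_le.1 hp))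
  rw [← ha] at h1 h2 ⊢
  cases hb : ordAt H.y p with
  | top => rw [hb] at h1; simp at h1
  | coe b =>
    rw [hb] at h1 h2
    rw [h, ← WithTop.coe_nsmul, nsmul_eq_mul] at h2
    have h3 : ((2 * b : ℤ) : WithTop ℤ) = (((2 * g + 1 : ℕ) * a : ℤ) : WithTop ℤ) := h2
    have h4 : ((b + (g + 1 : ℕ) * -a : ℤ) : WithTop ℤ) = ((1 : ℤ) : WithTop ℤ) := h1
    rw [WithTop.coe_inj] at h3 h4
    push_cast at h3 h4
    -- With `a` and `b` the orders of `x` and `y`, `2b = (2g + 1) a` and `b - (g + 1) a = 1`.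
    have h5 : a = -2 := by linear_combination h3 - 2 * h4
    rw [h5]
    rfl

variable (H) in
theorem exists_finset_poles [CompactSpace X] [T2Space X] : ∃ P : Finset X,
    (∀ p, p ∈ P ↔ ¬ H.IsFinite p) ∧
      ((H.r = 2 * g + 1 ∧ P.card = 1 ∧ ∀ p ∈ P, ordAt H.x p = -2) ∨
        (H.r = 2 * g + 2 ∧ P.card = 2 ∧ ∀ p ∈ P, ordAt H.x p = -1)) := by
  classical
  rcases H.r_eq with h | h
  · obtain ⟨p, hp, hv⟩ := H.exists_pole (c := 0) (by simp [H.reversePoly_zero_of_odd h])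
    have h1 : ∀ q, q ∈ ({p} : Finset X) ↔ ¬ H.IsFinite q := by
      intro q
      rw [Finset.mem_singleton]
      refine ⟨fun h => h ▸ hp, fun hq => pole_eq_of_v_eq hq hp ?_⟩
      have := sq_v_of_pole hq
      rwa [H.reversePoly_zero_of_odd h, sq_eq_zero_iff, ← hv] at this
    exact ⟨{p}, h1, Or.inl ⟨h, by simp, fun q hq => ordAt_x_of_odd ((h1 q).1 hq) h⟩⟩
  · obtain ⟨p, hp, hv⟩ := H.exists_pole (c := 1) (by simp [H.reversePoly_zero_of_even h])
    obtain ⟨p', hp', hv'⟩ := H.exists_pole (c := -1) (by simp [H.reversePoly_zero_of_even h])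
    have hne : p ≠ p' := by
      rintro rfl
      rw [hv] at hv'
      norm_num at hv'
    have h1 : ∀ q, q ∈ ({p, p'} : Finset X) ↔ ¬ H.IsFinite q := by
      intro q
      rw [Finset.mem_insert, Finset.mem_singleton]
      refine ⟨fun h => h.elim (fun h => h ▸ hp) (fun h => h ▸ hp'), fun hq => ?_⟩
      have := sq_v_of_pole hq
      rw [H.reversePoly_zero_of_even h] at this
      exact (sq_eq_sq_iff_eq_or_eq_neg.1 (this.trans (one_pow 2).symm)).imp
        (fun h => pole_eq_of_v_eq hq hp (h.trans hv.symm))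
        (fun h => pole_eq_of_v_eq hq hp' (h.trans hv'.symm))
    exact ⟨{p, p'}, h1, Or.inr ⟨h, Finset.card_pair hne,
      fun q hq => ordAt_x_of_even ((h1 q).1 hq) h⟩⟩

end Infinity
end HyperellipticModel
end RiemannSurface

namespace RiemannSurface

/-! ### Canonical divisors. -/

section Canonical

variable {X : Type*} [TopologicalSpace X] [ChartedSpace ℂ X] [IsManifold 𝓘(ℂ) ω X]

/-- The quotient of two 1-forms is a meromorphic function. Evaluating both at the tangent vector `1`
is harmless even though this need not be a holomorphic frame: on a line the quotient does not depend
on the vector. -/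
theorem IsCanonicalDivisor.sub_mem_principalDivisors {K K' : X →₀ ℤ} (hK : IsCanonicalDivisor K)
    (hK' : IsCanonicalDivisor K') : K - K' ∈ principalDivisors X := by
  obtain ⟨η, hη⟩ := hK
  obtain ⟨η', hη'⟩ := hK'
  let f : X → ℂ := fun q => η q (show TangentSpace 𝓘(ℂ) q from (1 : ℂ)) /
    η' q (show TangentSpace 𝓘(ℂ) q from (1 : ℂ))
  have hf : ∀ p, f ∘ (chartAt ℂ p).symm =ᶠ[𝓝[≠] (chartAt ℂ p p)]
      formCoeff η p * (formCoeff η' p)⁻¹ := by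
    intro p
    filter_upwards [nhdsWithin_le_nhds
      ((chartAt ℂ p).open_target.mem_nhds (mem_chart_target ℂ p))] with z hz
    have h1 := mfderiv_chartAt_symm_ne_zero hz
    simp only [Function.comp_apply, Pi.mul_apply, Pi.inv_apply, formCoeff, f]
    rw [tangent_apply_eq (η _), tangent_apply_eq (η' _), ← div_eq_mul_inv]
    exact (mul_div_mul_left _ _ h1).symm
  refine ⟨f, fun p => ((hη p).1.mul (hη' p).1.inv).congr (hf p).symm, fun p => ?_⟩
  rw [ordAt, meromorphicOrderAt_congr (hf p), meromorphicOrderAt_mul (hη p).1 (hη' p).1.inv,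
    meromorphicOrderAt_inv, (hη p).2, (hη' p).2, Finsupp.sub_apply, sub_eq_add_neg]
  rfl

end Canonical

namespace HyperellipticModel

/-! ### The branch set and the divisors of `x - e i`, `y` and `dx / y`. -/

section Divisors

variable {g : ℕ} {X : Type*} [TopologicalSpace X] [ChartedSpace ℂ X]
  (H : HyperellipticModel g X)

theorem exists_branchPoint (i : Fin H.r) : ∃ p, H.IsFinite p ∧ H.x p = H.e i ∧ H.y p = 0 :=
  H.exists_point (by rw [H.poly_eq_zero_iff.2 ⟨i, rfl⟩, zero_pow two_ne_zero])

/-- The ramification point over the root `e i`. -/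
noncomputable def branchPoint (i : Fin H.r) : X := (H.exists_branchPoint i).choose

theorem isFinite_branchPoint (i : Fin H.r) : H.IsFinite (H.branchPoint i) :=
  (H.exists_branchPoint i).choose_spec.1

theorem x_branchPoint (i : Fin H.r) : H.x (H.branchPoint i) = H.e i :=
  (H.exists_branchPoint i).choose_spec.2.1

theorem y_branchPoint (i : Fin H.r) : H.y (H.branchPoint i) = 0 :=
  (H.exists_branchPoint i).choose_spec.2.2

theorem branchPoint_injective : Function.Injective H.branchPoint := by
  intro i j h
  rw [← H.e_injective.eq_iff, ← H.x_branchPoint, ← H.x_branchPoint, h]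

theorem eq_branchPoint_iff {p : X} (hp : H.IsFinite p) (i : Fin H.r) :
    p = H.branchPoint i ↔ H.x p = H.e i := by
  refine ⟨fun h => h ▸ H.x_branchPoint i, fun h => H.eq_of_x_eq_of_y_eq hp
    (H.isFinite_branchPoint i) (h.trans (H.x_branchPoint i).symm) ?_⟩
  rw [H.y_branchPoint, H.y_eq_zero_iff hp]
  exact ⟨i, h⟩

theorem y_eq_zero_iff_exists_branchPoint {p : X} (hp : H.IsFinite p) :
    H.y p = 0 ↔ ∃ i, p = H.branchPoint i := by
  simp_rw [H.y_eq_zero_iff hp, H.eq_branchPoint_iff hp]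

/-- `1` if one of the branch points is a pole of `x`, and `0` otherwise. -/
def parity : ℕ := if H.r = 2 * g + 1 then 1 else 0

variable [IsManifold 𝓘(ℂ) ω X]

theorem ordAt_x_of_pole {p : X} (hp : ¬ H.IsFinite p) :
    ordAt H.x p = ((-(H.parity + 1 : ℤ) : ℤ) : WithTop ℤ) := by
  rcases H.r_eq with h | h
  · rw [ordAt_x_of_odd hp h, parity, if_pos h]; rfl
  · rw [ordAt_x_of_even hp h, parity, if_neg (by omega)]; rfl

theorem ordAt_y_of_pole {p : X} (hp : ¬ H.IsFinite p) :
    ordAt H.y p = ((H.parity - (g + 1) * (H.parity + 1) : ℤ) : WithTop ℤ) := by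
  have h1 := two_mul_ordAt_y_of_pole hp
  rw [H.ordAt_x_of_pole hp, ← WithTop.coe_nsmul, nsmul_eq_mul] at h1
  cases hb : ordAt H.y p with
  | top =>
    rw [hb, WithTop.mul_top (by decide)] at h1
    exact absurd h1.symm (WithTop.coe_ne_top)
  | coe b =>
    rw [hb] at h1
    have h2 : ((2 * b : ℤ) : WithTop ℤ) = ((H.r * -(H.parity + 1 : ℤ) : ℤ) : WithTop ℤ) := h1
    rw [WithTop.coe_inj] at h2 ⊢
    rcases H.r_eq with h | h
    · rw [parity, if_pos h] at *
      rw [h] at h2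
      push_cast at *
      linarith
    · rw [parity, if_neg (by omega)] at *
      rw [h] at h2
      push_cast at *
      linarith

variable [CompactSpace X] [T2Space X]

/-- The poles of `x`. -/
noncomputable def poles : Finset X := H.exists_finset_poles.choose

theorem mem_poles {p : X} : p ∈ H.poles ↔ ¬ H.IsFinite p := H.exists_finset_poles.choose_spec.1 p

theorem card_poles_mul : H.poles.card * (H.parity + 1) = 2 := by
  rcases H.exists_finset_poles.choose_spec.2 with ⟨h1, h2, -⟩ | ⟨h1, h2, -⟩
  · rw [poles, h2, parity, if_pos h1]
  · rw [poles, h2, parity, if_neg (by omega)]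

/-- The divisor of poles of `x`. -/
noncomputable def polarDivisor : X →₀ ℤ := ∑ p ∈ H.poles, Finsupp.single p (H.parity + 1 : ℤ)

theorem polarDivisor_apply_of_finite {p : X} (hp : H.IsFinite p) : H.polarDivisor p = 0 := by
  classical
  rw [polarDivisor, Finsupp.finsetSum_apply]
  refine Finset.sum_eq_zero fun q hq => Finsupp.single_eq_of_ne ?_
  rintro rfl
  exact H.mem_poles.1 hq hp

theorem polarDivisor_apply_of_pole {p : X} (hp : ¬ H.IsFinite p) :
    H.polarDivisor p = H.parity + 1 := by
  classical
  rw [polarDivisor, Finsupp.finsetSum_apply, Finset.sum_eq_single p]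
  · simp
  · intro q _ hq
    exact Finsupp.single_eq_of_ne hq.symm
  · exact fun h => absurd (H.mem_poles.2 hp) h

open Classical in
/-- The ramification points of `x`. -/
noncomputable def branchFinset : Finset X :=
  Finset.univ.image H.branchPoint ∪ if H.r = 2 * g + 1 then H.poles else ∅

theorem mem_branchFinset_of_finite {p : X} (hp : H.IsFinite p) :
    p ∈ H.branchFinset ↔ ∃ i, p = H.branchPoint i := by
  have h1 : p ∉ H.poles := fun h => H.mem_poles.1 h hp
  rw [branchFinset]
  split_ifs <;> simp [h1, eq_comm]

theorem mem_branchFinset_of_pole {p : X} (hp : ¬ H.IsFinite p) :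
    p ∈ H.branchFinset ↔ H.r = 2 * g + 1 := by
  have h1 : p ∈ H.poles := H.mem_poles.2 hp
  have h2 : ∀ i, H.branchPoint i ≠ p := fun i h => hp (h ▸ H.isFinite_branchPoint i)
  rw [branchFinset]
  split_ifs with h <;> simp [h1, h2, h]

theorem branchPoint_mem_branchFinset (i : Fin H.r) : H.branchPoint i ∈ H.branchFinset :=
  (H.mem_branchFinset_of_finite (H.isFinite_branchPoint i)).2 ⟨i, rfl⟩

theorem coe_branchFinset : (H.branchFinset : Set X) = H.branchSet := by
  ext p
  rw [Finset.mem_coe, branchSet, mem_ofPred_eq]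
  by_cases hp : H.IsFinite p
  · rw [H.mem_branchFinset_of_finite hp, ← H.y_eq_zero_iff_exists_branchPoint hp]
    constructor
    · intro hy
      obtain ⟨i, hi⟩ := (H.y_eq_zero_iff hp).1 hy
      refine Or.inr ⟨hp, ?_⟩
      rw [hi, H.ordAt_x_sub_e hp hi]
    · rintro (h | ⟨-, h⟩)
      · exact absurd (le_trans (show (0 : WithTop ℤ) ≤ ordAt H.x p from hp) h) (by decide)
      · by_contra hy
        rw [H.ordAt_x_sub_of_y_ne_zero hp hy] at h
        exact absurd h (by decide)
  · rw [H.mem_branchFinset_of_pole hp]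
    constructor
    · intro h
      exact Or.inl (ordAt_x_of_odd hp h).le
    · rintro (h | ⟨h, -⟩)
      · refine H.r_eq.resolve_right fun h1 => ?_
        rw [ordAt_x_of_even hp h1] at h
        exact absurd h (by decide)
      · exact absurd h hp

theorem card_branchFinset : H.branchFinset.card = 2 * g + 2 := by
  classical
  have h1 : (Finset.univ.image H.branchPoint).card = H.r := by
    rw [Finset.card_image_of_injective _ H.branchPoint_injective, Finset.card_univ,
      Fintype.card_fin]
  rw [branchFinset]
  rcases H.r_eq with h | h
  · have h2 := H.card_poles_mul
    rw [parity, if_pos h] at h2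
    rw [if_pos h, Finset.card_union_of_disjoint, h1]
    · omega
    · rw [Finset.disjoint_left]
      intro p hp hp'
      obtain ⟨i, -, rfl⟩ := Finset.mem_image.1 hp
      exact H.mem_poles.1 hp' (H.isFinite_branchPoint i)
  · convert h1.trans h using 2
    rw [if_neg (by omega), Finset.union_empty]

theorem single_branchPoint_sub_mem (i : Fin H.r) :
    Finsupp.single (H.branchPoint i) 2 - H.polarDivisor ∈ principalDivisors X := by
  refine ⟨fun q => H.x q - H.e i, H.isMeromorphic_x.sub_const _, fun p => ?_⟩
  rw [Finsupp.sub_apply]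
  by_cases hp : H.IsFinite p
  · rw [H.polarDivisor_apply_of_finite hp, sub_zero]
    by_cases h : H.x p = H.e i
    · rw [H.ordAt_x_sub_e hp h, (H.eq_branchPoint_iff hp i).2 h, Finsupp.single_eq_same]
      rfl
    · rw [H.ordAt_x_sub_of_ne hp h, Finsupp.single_eq_of_ne]
      · rfl
      · exact fun h1 => h ((H.eq_branchPoint_iff hp i).1 h1)
  · rw [ordAt_x_sub_of_pole hp, H.ordAt_x_of_pole hp, H.polarDivisor_apply_of_pole hp,
      Finsupp.single_eq_of_ne, zero_sub]
    rintro rfl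
    exact hp (H.isFinite_branchPoint i)

/-- At a finite branch point this is the divisor of `x - e i`; a branch point at infinity is the
only pole of `x`, and the two divisors coincide. -/
theorem single_two_sub_polarDivisor_mem {b : X} (hb : b ∈ H.branchFinset) :
    Finsupp.single b 2 - H.polarDivisor ∈ principalDivisors X := by
  by_cases hp : H.IsFinite b
  · obtain ⟨i, rfl⟩ := (H.mem_branchFinset_of_finite hp).1 hb
    exact H.single_branchPoint_sub_mem i
  · have h := (H.mem_branchFinset_of_pole hp).1 hb
    have h2 := H.card_poles_mul
    rw [parity, if_pos h] at h2
    obtain ⟨c, hc⟩ := Finset.card_eq_one.1 (show H.poles.card = 1 by omega)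
    have h3 : b = c := by
      have := H.mem_poles.2 hp
      rwa [hc, Finset.mem_singleton] at this
    have h4 : H.polarDivisor = Finsupp.single b 2 := by
      rw [polarDivisor, hc, Finset.sum_singleton, parity, if_pos h, h3]
      norm_num
    rw [h4, sub_self]
    exact zero_mem _

theorem sum_branchFinset_sub_mem :
    ∑ b ∈ H.branchFinset, Finsupp.single b 1 - (g + 1 : ℤ) • H.polarDivisor ∈
      principalDivisors X := by
  classical
  refine ⟨H.y, H.isMeromorphic_y, fun p => ?_⟩
  have h1 : (∑ b ∈ H.branchFinset, Finsupp.single b (1 : ℤ)) p =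
      if p ∈ H.branchFinset then 1 else 0 := by
    rw [Finsupp.finsetSum_apply]
    simp [Finsupp.single_apply]
  rw [Finsupp.sub_apply, h1, Finsupp.smul_apply]
  by_cases hp : H.IsFinite p
  · simp only [H.polarDivisor_apply_of_finite hp, H.mem_branchFinset_of_finite hp,
      ← H.y_eq_zero_iff_exists_branchPoint hp]
    split_ifs with h
    · rw [H.ordAt_y_of_eq_zero hp h]; simp
    · rw [H.ordAt_y_of_ne_zero hp h]; simp
  · simp only [H.polarDivisor_apply_of_pole hp, H.mem_branchFinset_of_pole hp,
      H.ordAt_y_of_pole hp, smul_eq_mul]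
    congr 2
    rw [parity]
    push_cast
    rfl

/-- The form is `dx / y`. At finite branch points the simple zeros of `dx` and `y` cancel. -/
theorem isCanonicalDivisor_smul_polarDivisor :
    IsCanonicalDivisor ((g - 1 : ℤ) • H.polarDivisor) := by
  let η : ∀ q : X, TangentSpace 𝓘(ℂ) q →L[ℂ] ℂ := fun q =>
    (H.y q)⁻¹ • (show TangentSpace 𝓘(ℂ) q →L[ℂ] ℂ from mfderiv 𝓘(ℂ) 𝓘(ℂ) H.x q)
  have hη : ∀ p, formCoeff η p =ᶠ[𝓝[≠] (chartAt ℂ p p)]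
      (H.y ∘ (chartAt ℂ p).symm)⁻¹ * deriv (H.x ∘ (chartAt ℂ p).symm) := by
    intro p
    filter_upwards [nhdsWithin_le_nhds
      ((chartAt ℂ p).open_target.mem_nhds (mem_chart_target ℂ p)), eventually_chartAt_symm_iff.2
      (H.isMeromorphic_x.eventually_mdifferentiableAt p)] with z hz hzd
    rw [Pi.mul_apply, deriv_comp_chartAt_symm hz hzd]
    rfl
  refine ⟨η, fun p => ⟨((H.isMeromorphic_y p).inv.mul (H.isMeromorphic_x p).deriv).congr
    (hη p).symm, ?_⟩⟩
  -- Subtracting a constant leaves `dx` unchanged but gives the function a nonzero order, so that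
  -- differentiation lowers the order by exactly one.
  have hd : ∀ c, deriv (H.x ∘ (chartAt ℂ p).symm) =
      deriv ((fun q => H.x q - c) ∘ (chartAt ℂ p).symm) := by
    intro c
    funext z
    exact (deriv_sub_const c).symm
  rw [meromorphicOrderAt_congr (hη p), meromorphicOrderAt_mul (H.isMeromorphic_y p).inv
    (H.isMeromorphic_x p).deriv, meromorphicOrderAt_inv]
  change -ordAt H.y p + _ = _
  by_cases hp : H.IsFinite p
  · rw [Finsupp.smul_apply, H.polarDivisor_apply_of_finite hp, smul_zero]
    by_cases hy : H.y p = 0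
    · obtain ⟨i, hi⟩ := (H.y_eq_zero_iff hp).1 hy
      rw [H.ordAt_y_of_eq_zero hp hy, hd (H.e i),
        meromorphicOrderAt_deriv_eq_sub_one (n := 2) (by norm_num) (H.ordAt_x_sub_e hp hi)]
      rfl
    · rw [H.ordAt_y_of_ne_zero hp hy, hd (H.x p), meromorphicOrderAt_deriv_eq_sub_one (n := 1)
        (by norm_num) (H.ordAt_x_sub_of_y_ne_zero hp hy)]
      rfl
  · have hne : (((-(H.parity + 1 : ℤ)) : ℤ) : ℂ) ≠ 0 := by
      rw [Int.cast_ne_zero]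
      omega
    rw [meromorphicOrderAt_deriv_eq_sub_one hne (H.ordAt_x_of_pole hp), H.ordAt_y_of_pole hp,
      Finsupp.smul_apply, H.polarDivisor_apply_of_pole hp, smul_eq_mul]
    change (((-(H.parity - (g + 1) * (H.parity + 1) : ℤ)) + (-(H.parity + 1 : ℤ) - 1) : ℤ) :
      WithTop ℤ) = _
    congr 1
    ring

end Divisors
end HyperellipticModel
end RiemannSurface

/-! ### Principal divisors supported on the branch set. -/

namespace RiemannSurface

/-- Either `f` or its inverse has no poles. This replaces the theorem that principal divisors have
degree zero. -/
theorem IsMeromorphic.exists_eventually_eq_const_of_ordAt {X : Type*} [TopologicalSpace X]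
    [ChartedSpace ℂ X] [IsManifold 𝓘(ℂ) ω X] [CompactSpace X] [ConnectedSpace X]
    {f : X → ℂ} (hf : IsMeromorphic f) (N : ℤ) (h : ∀ p, ordAt f p = 0 ∨ ordAt f p = N) :
    ∃ c ≠ 0, ∀ p, ∀ᶠ q in 𝓝[≠] p, f q = c := by
  wlog hN : 0 ≤ N generalizing f N
  · obtain ⟨c, hc, hfc⟩ := this (f := fun q => (f q)⁻¹) hf.inv (-N) (fun p => by
      rw [ordAt_inv]
      refine (h p).imp (fun h => ?_) (fun h => ?_)
      · rw [h]; rfl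
      · rw [h]; rfl) (by omega)
    exact ⟨c⁻¹, inv_ne_zero hc, fun p => (hfc p).mono fun q hq => by rw [← hq, inv_inv]⟩
  · obtain ⟨c, hc⟩ := hf.exists_eventually_eq_const fun p => by
      rcases h p with h | h
      · exact h.ge
      · rw [h]
        exact_mod_cast hN
    refine ⟨c, ?_, hc⟩
    rintro rfl
    obtain ⟨p⟩ := (inferInstance : Nonempty X)
    have h1 : ordAt f p = ⊤ :=
      meromorphicOrderAt_eq_top_iff.2 (eventually_chartAt_symm_iff.2 (hc p))
    rcases h p with h | h
    · rw [h] at h1; exact WithTop.coe_ne_top h1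
    · rw [h] at h1; exact WithTop.coe_ne_top h1

namespace HyperellipticModel

variable {g : ℕ} {X : Type*} [TopologicalSpace X] [ChartedSpace ℂ X] [IsManifold 𝓘(ℂ) ω X]
  (H : HyperellipticModel g X)

/-- `q` is the image of `p ∈ X` under the hyperelliptic involution `(x, y) ↦ (x, -y)`, and `p` is
neither a pole nor a ramification point of `x`. -/
def IsConjugate (p q : X) : Prop :=
  H.IsFinite p ∧ H.IsFinite q ∧ H.y p ≠ 0 ∧ H.x q = H.x p ∧ H.y q = -H.y p

section Sign

variable {H} {φ : X → ℂ}

/-- `x` is open near both points of a conjugate pair. Over a nearby value, continuity keeps `y` from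
agreeing at the two points, so they are again conjugate, and keeps `φ` from acquiring the opposite
sign. -/
theorem isOpen_image_conjugate (hc : ∀ p, H.IsFinite p → H.y p ≠ 0 → ContinuousAt φ p ∧ φ p ≠ 0)
    (hsq : ∀ p q, H.IsConjugate p q → φ q ^ 2 = φ p ^ 2) {ε : ℂ} (hε : ε ^ 2 = 1) :
    IsOpen {t | ∃ p q, H.IsConjugate p q ∧ φ q = ε * φ p ∧ H.x p = t} := by
  rw [isOpen_iff_mem_nhds]
  rintro t ⟨p, q, ⟨hp, hq, hy, hx, hyq⟩, hφ, rfl⟩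
  have hyq0 : H.y q ≠ 0 := by rwa [hyq, neg_ne_zero]
  have hε0 : ε ≠ 0 := by rintro rfl; simp at hε
  have h1 : ∀ᶠ a in 𝓝 p ×ˢ 𝓝 q, H.y a.1 ≠ H.y a.2 := by
    refine ((((H.continuousAt_y hp).tendsto.comp tendsto_fst).sub
      ((H.continuousAt_y hq).tendsto.comp tendsto_snd)).eventually_ne
      (sub_ne_zero.2 ?_)).mono fun _ => sub_ne_zero.1
    rw [hyq]
    exact (neg_ne_self.2 hy).symm
  have h2 : ∀ᶠ a in 𝓝 p ×ˢ 𝓝 q, φ a.2 ≠ -(ε * φ a.1) := by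
    refine ((((hc q hq hyq0).1.tendsto.comp tendsto_snd).sub
      (((hc p hp hy).1.tendsto.comp tendsto_fst).const_mul ε).neg).eventually_ne
      (sub_ne_zero.2 ?_)).mono fun _ => sub_ne_zero.1
    rw [hφ]
    exact (neg_ne_self.2 (mul_ne_zero hε0 (hc p hp hy).2)).symm
  obtain ⟨U, hU, V, hV, hUV⟩ := eventually_prod_iff.1 (h1.and h2)
  have hU' := image_mem_map (m := H.x) ((hU.and ((H.eventually_isFinite hp).and
    ((H.continuousAt_y hp).eventually_ne hy))))
  have hV' := image_mem_map (m := H.x) (hV.and (H.eventually_isFinite hq))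
  rw [H.map_x_nhds hp hy] at hU'
  rw [H.map_x_nhds hq hyq0, hx] at hV'
  filter_upwards [hU', hV']
  rintro t ⟨p', ⟨hpU, hp', hyp'⟩, rfl⟩ ⟨q', ⟨hqV, hq'⟩, hxq'⟩
  obtain ⟨h3, h4⟩ := hUV hpU hqV
  have h5 : H.y q' = -H.y p' := by
    refine (sq_eq_sq_iff_eq_or_eq_neg.1 ?_).resolve_left (Ne.symm h3)
    rw [H.sq_y hp', H.sq_y hq', hxq']
  have h6 : H.IsConjugate p' q' := ⟨hp', hq', hyp', hxq', h5⟩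
  refine ⟨p', q', h6, (sq_eq_sq_iff_eq_or_eq_neg.1 ?_).resolve_right h4, rfl⟩
  rw [hsq p' q' h6, mul_pow, hε, one_mul]

/-- A function which agrees up to sign at conjugate points is even or odd under the involution. -/
theorem exists_sign (hc : ∀ p, H.IsFinite p → H.y p ≠ 0 → ContinuousAt φ p ∧ φ p ≠ 0)
    (hsq : ∀ p q, H.IsConjugate p q → φ q ^ 2 = φ p ^ 2) :
    ∃ ε : ℂ, (ε = 1 ∨ ε = -1) ∧ ∀ p q, H.IsConjugate p q → φ q = ε * φ p := by
  have hconn : IsPreconnected (range H.e)ᶜ :=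
    ((finite_range H.e).countable.isConnected_compl_of_one_lt_rank (by simp)).isPreconnected
  -- A fibre is a single pair of points, so one conjugate pair over `t` settles both orderings, as
  -- `ε² = 1`.
  have key : ∀ ε : ℂ, ε ^ 2 = 1 → ((range H.e)ᶜ ⊆
      {t | ∃ p q, H.IsConjugate p q ∧ φ q = ε * φ p ∧ H.x p = t}) →
      ∀ p q, H.IsConjugate p q → φ q = ε * φ p := by
    intro ε hε hsub p q hpq
    have hx : H.x p ∈ (range H.e)ᶜ := by
      rintro ⟨i, hi⟩
      exact hpq.2.2.1 ((H.y_eq_zero_iff hpq.1).2 ⟨i, hi.symm⟩)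
    obtain ⟨p', q', hpq', hφ, hxp⟩ := hsub hx
    obtain ⟨hp, hq, hy, hxq, hyq⟩ := hpq
    obtain ⟨hp', hq', hy', hxq', hyq'⟩ := hpq'
    have h1 : H.y p' ^ 2 = H.y p ^ 2 := by rw [H.sq_y hp, H.sq_y hp', hxp]
    rcases sq_eq_sq_iff_eq_or_eq_neg.1 h1 with h | h
    · rw [← H.eq_of_x_eq_of_y_eq hp' hp hxp h, ← H.eq_of_x_eq_of_y_eq hq' hq
        (by rw [hxq', hxq, hxp]) (by rw [hyq', hyq, h]), hφ]
    · rw [← H.eq_of_x_eq_of_y_eq hp' hq (by rw [hxp, hxq]) (by rw [h, hyq]),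
        ← H.eq_of_x_eq_of_y_eq hq' hp (by rw [hxq', hxp]) (by rw [hyq', h, neg_neg]), hφ,
        ← mul_assoc, ← sq, hε, one_mul]
  have hcover : (range H.e)ᶜ ⊆ {t | ∃ p q, H.IsConjugate p q ∧ φ q = 1 * φ p ∧ H.x p = t} ∪
      {t | ∃ p q, H.IsConjugate p q ∧ φ q = -1 * φ p ∧ H.x p = t} := by
    intro t ht
    obtain ⟨b, hb⟩ := IsAlgClosed.exists_pow_nat_eq (H.poly t) two_pos
    obtain ⟨p, hp, rfl, rfl⟩ := H.exists_point hb
    obtain ⟨q, hq, hxq, hyq⟩ := H.exists_point (a := H.x p) (b := -H.y p) (by rw [neg_sq, hb])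
    have hpq : H.IsConjugate p q := ⟨hp, hq, fun h => ht
      (by obtain ⟨i, hi⟩ := (H.y_eq_zero_iff hp).1 h; exact ⟨i, hi.symm⟩), hxq, hyq⟩
    rcases sq_eq_sq_iff_eq_or_eq_neg.1 (hsq p q hpq) with h | h
    · exact Or.inl ⟨p, q, hpq, by rw [h, one_mul], rfl⟩
    · exact Or.inr ⟨p, q, hpq, by rw [h, neg_one_mul], rfl⟩
  have hdisj : (range H.e)ᶜ ∩ ({t | ∃ p q, H.IsConjugate p q ∧ φ q = 1 * φ p ∧ H.x p = t} ∩
      {t | ∃ p q, H.IsConjugate p q ∧ φ q = -1 * φ p ∧ H.x p = t}) = ∅ := by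
    rw [eq_empty_iff_forall_notMem]
    rintro _ ⟨-, ⟨p, q, ⟨hp, hq, hy, hxq, hyq⟩, hφ, rfl⟩,
      ⟨p', q', ⟨hp', hq', hy', hxq', hyq'⟩, hφ', hxp⟩⟩
    have h0 := (hc p' hp' hy').2
    have h1 : H.y p' ^ 2 = H.y p ^ 2 := by rw [H.sq_y hp, H.sq_y hp', hxp]
    have h2 : φ q' = φ p' := by
      rcases sq_eq_sq_iff_eq_or_eq_neg.1 h1 with h | h
      · rw [H.eq_of_x_eq_of_y_eq hp' hp hxp h, H.eq_of_x_eq_of_y_eq hq' hq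
          (by rw [hxq', hxq, hxp]) (by rw [hyq', hyq, h]), hφ, one_mul]
      · rw [H.eq_of_x_eq_of_y_eq hp' hq (by rw [hxp, hxq]) (by rw [h, hyq]),
          H.eq_of_x_eq_of_y_eq hq' hp (by rw [hxq', hxp]) (by rw [hyq', h, neg_neg]), hφ, one_mul]
    rw [hφ', neg_one_mul] at h2
    exact neg_ne_self.2 h0 h2
  rcases isPreconnected_iff_subset_of_disjoint.1 hconn _ _
    (isOpen_image_conjugate hc hsq (by norm_num)) (isOpen_image_conjugate hc hsq (by norm_num))
    hcover hdisj with h | h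
  · exact ⟨1, Or.inl rfl, key 1 (by norm_num) h⟩
  · exact ⟨-1, Or.inr rfl, key (-1) (by norm_num) h⟩

end Sign

/-- `y` is a local coordinate at the branch point, so it takes values `t` and `-t` nearby. Then
`poly x = t²` at both points, and `poly` is injective near its simple root. -/
theorem exists_isConjugate_mem (i : Fin H.r) {U : Set X} (hU : U ∈ 𝓝 (H.branchPoint i)) :
    ∃ p ∈ U, ∃ q ∈ U, H.IsConjugate p q := by
  have hfin := H.isFinite_branchPoint i
  obtain ⟨s, hs, hinj⟩ := exists_injOn_of_deriv_ne_zero (H.analyticAt_poly (H.e i))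
    (H.deriv_poly_ne_zero i)
  have hs' : ∀ᶠ q in 𝓝 (H.branchPoint i), H.x q ∈ s := by
    refine (H.continuousAt_x hfin).eventually ?_
    rwa [H.x_branchPoint]
  have hV := image_mem_map (m := H.y) ((eventually_mem_set.2 hU).and
    ((H.eventually_isFinite hfin).and hs'))
  rw [H.map_y_nhds hfin (H.y_branchPoint i), H.y_branchPoint] at hV
  have hV' : ∀ᶠ t : ℂ in 𝓝 0, -t ∈ H.y '' {q | q ∈ U ∧ H.IsFinite q ∧ H.x q ∈ s} := by
    have : Tendsto (fun t : ℂ => -t) (𝓝 0) (𝓝 0) := by simpa using (tendsto_id (x := 𝓝 (0 : ℂ))).neg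
    exact this hV
  obtain ⟨t, ⟨⟨p, ⟨hpU, hp, hps⟩, hpt⟩, ⟨q, ⟨hqU, hq, hqs⟩, hqt⟩⟩, ht⟩ :=
    (((eventually_mem_set.2 hV).and hV').filter_mono nhdsWithin_le_nhds |>.and
      (self_mem_nhdsWithin (a := (0 : ℂ)) (s := {0}ᶜ))).exists
  refine ⟨p, hpU, q, hqU, hp, hq, by rw [hpt]; exact ht, hinj hqs hps ?_, by rw [hqt, hpt]⟩
  rw [← H.sq_y hp, ← H.sq_y hq, hpt, hqt, neg_sq]

/-- `f y ^ (-a)` has a nonzero limit `c` at the branch point. Between conjugate points it is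
multiplied by `ε (-1) ^ a = ±1`, and the sign `-1` is impossible when both values are close to `c`.
-/
theorem sign_eq_neg_one_zpow {f : X → ℂ} (hf : IsMeromorphic f) {ε : ℂ} (hε : ε = 1 ∨ ε = -1)
    (h : ∀ p q, H.IsConjugate p q → limitFunction f q = ε * limitFunction f p) (i : Fin H.r)
    {a : ℤ} (ha : ordAt f (H.branchPoint i) = a) : ε = (-1) ^ a := by
  have hfin := H.isFinite_branchPoint i
  have h1 : ordAt (fun q => f q * H.y q ^ (-a)) (H.branchPoint i) = 0 := by
    rw [ordAt_mul hf (H.isMeromorphic_y.zpow _), ordAt_zpow H.isMeromorphic_y, ha,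
      H.ordAt_y_of_eq_zero hfin (H.y_branchPoint i)]
    change ((a + -a * 1 : ℤ) : WithTop ℤ) = _
    simp
  obtain ⟨c, hc0, hc⟩ := (hf.mul (H.isMeromorphic_y.zpow _)).tendsto_ne_zero_iff.2 h1
  have h2 := eventually_nhdsWithin_iff.1 ((hf.limitFunction_eventuallyEq (H.branchPoint i)).and
    (hc.eventually (Metric.ball_mem_nhds c (norm_pos_iff.2 hc0))))
  obtain ⟨p, hp, q, hq, hpq⟩ := H.exists_isConjugate_mem i h2
  have hφ := h p q hpq
  obtain ⟨-, -, hy, -, hyq⟩ := hpq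
  have hpne : p ≠ H.branchPoint i := fun h => hy (by rw [h, H.y_branchPoint])
  have hqne : q ≠ H.branchPoint i := fun h => hy (by rw [← neg_eq_zero, ← hyq, h, H.y_branchPoint])
  obtain ⟨hp1, hp2⟩ := hp hpne
  obtain ⟨hq1, hq2⟩ := hq hqne
  rw [hp1, hq1] at hφ
  have hs : (-1 : ℂ) ^ (-a) = (-1) ^ a := by
    rw [zpow_neg, ← inv_zpow, inv_neg, inv_one]
  have h3 : f q * H.y q ^ (-a) = (ε * (-1) ^ a) * (f p * H.y p ^ (-a)) := by
    rw [hφ, hyq, neg_eq_neg_one_mul, mul_zpow, hs]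
    ring
  have h4 : ε * (-1) ^ a ≠ -1 := by
    intro h4
    rw [h4, neg_one_mul] at h3
    rw [dist_eq_norm] at hp2 hq2
    have h5 : ‖2 * c‖ ≤ ‖f p * H.y p ^ (-a) - c‖ + ‖f q * H.y q ^ (-a) - c‖ := by
      refine le_trans (le_of_eq ?_) (norm_add_le _ _)
      rw [h3, ← norm_neg]
      congr 1
      ring
    rw [norm_mul, Complex.norm_ofNat] at h5
    linarith
  rcases Int.even_or_odd a with h5 | h5
  · rw [h5.neg_one_zpow] at h4 ⊢
    rw [mul_one] at h4
    exact hε.resolve_right h4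
  · rw [h5.neg_one_zpow] at h4 ⊢
    exact hε.resolve_left fun h6 => h4 (by rw [h6, one_mul])

variable [CompactSpace X] [T2Space X]

theorem sum_branchFinset (F : X → ℤ) {p₀ : X} (hp₀ : ¬ H.IsFinite p₀) :
    ∑ b ∈ H.branchFinset, F b = ∑ i, F (H.branchPoint i) + H.parity * F p₀ := by
  classical
  have h1 : ∑ b ∈ Finset.univ.image H.branchPoint, F b = ∑ i, F (H.branchPoint i) :=
    Finset.sum_image fun i _ j _ h => H.branchPoint_injective h
  have hd : Disjoint (Finset.univ.image H.branchPoint) H.poles := by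
    rw [Finset.disjoint_left]
    intro p hp hp'
    obtain ⟨i, -, rfl⟩ := Finset.mem_image.1 hp
    exact H.mem_poles.1 hp' (H.isFinite_branchPoint i)
  rcases H.r_eq with h | h
  · have h2 := H.card_poles_mul
    rw [parity, if_pos h] at h2
    obtain ⟨c, hc⟩ := Finset.card_eq_one.1 (show H.poles.card = 1 by omega)
    have h3 : p₀ = c := by
      have := H.mem_poles.2 hp₀
      rwa [hc, Finset.mem_singleton] at this
    have h4 : H.branchFinset = Finset.univ.image H.branchPoint ∪ H.poles := by
      rw [branchFinset, if_pos h]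
    rw [h4, Finset.sum_union hd, h1, hc, Finset.sum_singleton, parity, if_pos h, h3]
    simp
  · have h4 : H.branchFinset = Finset.univ.image H.branchPoint := by
      rw [branchFinset, if_neg (by omega), Finset.union_empty]
    rw [h4, h1, parity, if_neg (by omega)]
    simp

theorem exists_not_isFinite : ∃ p, ¬ H.IsFinite p := by
  have h := H.card_poles_mul
  obtain ⟨p, hp⟩ : H.poles.Nonempty := by
    rw [← Finset.card_pos]
    by_contra h0
    rw [Nat.eq_zero_of_not_pos h0, zero_mul] at h
    omega
  exact ⟨p, H.mem_poles.1 hp⟩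

theorem pole_unique_of_odd (h : H.r = 2 * g + 1) {p q : X} (hp : ¬ H.IsFinite p)
    (hq : ¬ H.IsFinite q) : p = q := by
  have h2 := H.card_poles_mul
  rw [parity, if_pos h] at h2
  exact Finset.card_le_one.1 (show H.poles.card ≤ 1 by omega) p (H.mem_poles.2 hp) q
    (H.mem_poles.2 hq)

-- At a finite branch point the order `2 A` of `f²` cancels against the double zero of `x - e i`. At
-- infinity every pole gives the same value: there is only one in odd degree, and `A` vanishes at
-- both in even degree.
open Classical in
theorem ordAt_sq_mul_prod {f : X → ℂ} (hf : IsMeromorphic f) {A : X →₀ ℤ}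
    (hA : ∀ p, ordAt f p = A p) (hB : ∀ p, p ∉ H.branchFinset → A p = 0) {p₀ : X}
    (hp₀ : ¬ H.IsFinite p₀) (p : X) :
    ordAt (fun q => f q ^ 2 * ∏ i, (H.x q - H.e i) ^ (-A (H.branchPoint i))) p =
      ((if H.IsFinite p then 0 else
        2 * A p₀ + (H.parity + 1) * ∑ i, A (H.branchPoint i) : ℤ) : WithTop ℤ) := by
  classical
  have hm := fun i => H.isMeromorphic_x.sub_const (H.e i)
  have key : ∀ o : Fin H.r → ℤ, (∀ i, ordAt (fun q => H.x q - H.e i) p = o i) →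
      ordAt (fun q => f q ^ 2 * ∏ i, (H.x q - H.e i) ^ (-A (H.branchPoint i))) p =
        ((2 * A p + ∑ i, -A (H.branchPoint i) * o i : ℤ) : WithTop ℤ) := by
    intro o ho
    rw [ordAt_mul (hf.pow 2) (IsMeromorphic.prod fun i => (hm i).zpow _), ordAt_pow hf, hA,
      ordAt_prod (fun i => (hm i).zpow _), WithTop.coe_add, WithTop.coe_sum]
    congr 1
    refine Finset.sum_congr rfl fun i _ => ?_
    rw [ordAt_zpow (hm i), ho]
    rfl
  split_ifs with hp
  · rw [key (fun i => if p = H.branchPoint i then 2 else 0) fun i => ?_]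
    · congr 1
      by_cases hpB : p ∈ H.branchFinset
      · obtain ⟨j, rfl⟩ := (H.mem_branchFinset_of_finite hp).1 hpB
        rw [Finset.sum_eq_single j]
        · simp; ring
        · intro i _ hi
          rw [if_neg fun h => hi (H.branchPoint_injective h).symm, mul_zero]
        · simp
      · rw [hB p hpB, mul_zero, zero_add]
        refine Finset.sum_eq_zero fun i _ => ?_
        rw [if_neg, mul_zero]
        rintro rfl
        exact hpB (H.branchPoint_mem_branchFinset i)
    · rw [H.eq_branchPoint_iff hp]
      split_ifs with h
      · exact H.ordAt_x_sub_e hp h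
      · exact H.ordAt_x_sub_of_ne hp h
  · rw [key (fun _ => -(H.parity + 1 : ℤ)) fun i => ?_]
    · congr 1
      have h1 : A p = A p₀ := by
        rcases H.r_eq with h | h
        · rw [H.pole_unique_of_odd h hp hp₀]
        · have h2 : ∀ q, ¬ H.IsFinite q → A q = 0 := fun q hq =>
            hB q fun h3 => by have := (H.mem_branchFinset_of_pole hq).1 h3; omega
          rw [h2 p hp, h2 p₀ hp₀]
      rw [h1, ← Finset.sum_mul, Finset.sum_neg_distrib]
      ring
    · rw [ordAt_x_sub_of_pole hp, H.ordAt_x_of_pole hp]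

/-- A principal divisor supported on the branch set has degree zero, and its coefficients have the
same parity. -/
theorem sum_eq_zero_and_even_or_odd [ConnectedSpace X] {A : X →₀ ℤ} (hA : A ∈ principalDivisors X)
    (hB : ∀ p, p ∉ H.branchFinset → A p = 0) :
    ∑ b ∈ H.branchFinset, A b = 0 ∧
      ((∀ b ∈ H.branchFinset, Even (A b)) ∨ ∀ b ∈ H.branchFinset, Odd (A b)) := by
  classical
  obtain ⟨f, hf, hfA⟩ := hA
  obtain ⟨p₀, hp₀⟩ := H.exists_not_isFinite
  have hord := H.ordAt_sq_mul_prod hf hfA hB hp₀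
  have hmero : IsMeromorphic fun q => f q ^ 2 * ∏ i, (H.x q - H.e i) ^ (-A (H.branchPoint i)) :=
    (hf.pow 2).mul (IsMeromorphic.prod fun i => (H.isMeromorphic_x.sub_const _).zpow _)
  obtain ⟨c, hc0, hc⟩ := hmero.exists_eventually_eq_const_of_ordAt _ fun p => by
    rw [hord p]
    split_ifs
    exacts [Or.inl rfl, Or.inr rfl]
  -- The function is a nonzero constant near `p₀`, so its order there is zero.
  have hN : 2 * A p₀ + (H.parity + 1) * ∑ i, A (H.branchPoint i) = 0 := by
    have h1 := hord p₀
    rw [if_neg hp₀, ordAt_congr (hc p₀), ordAt_const hc0] at h1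
    exact (WithTop.coe_inj.1 h1).symm
  have hdeg : ∑ b ∈ H.branchFinset, A b = 0 := by
    rw [H.sum_branchFinset _ hp₀]
    rcases H.r_eq with h | h
    · rw [parity, if_pos h] at hN ⊢
      push_cast at hN ⊢
      linarith
    · rw [hB p₀ fun h1 => by have := (H.mem_branchFinset_of_pole hp₀).1 h1; omega] at hN ⊢
      rw [parity, if_neg (by omega)] at hN
      simpa using hN
  refine ⟨hdeg, ?_⟩
  have hA0 : ∀ p, H.IsFinite p → H.y p ≠ 0 → ordAt f p = 0 := by
    intro p hp hy
    rw [hfA, hB p fun h => hy ((H.y_eq_zero_iff_exists_branchPoint hp).2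
      ((H.mem_branchFinset_of_finite hp).1 h))]
    rfl
  have hφ : ∀ p, H.IsFinite p → H.y p ≠ 0 →
      ContinuousAt (limitFunction f) p ∧ limitFunction f p ≠ 0 := by
    intro p hp hy
    refine ⟨(hf.mdifferentiableAt_limitFunction (hA0 p hp hy).ge).continuousAt, ?_⟩
    obtain ⟨d, hd0, hd⟩ := hf.tendsto_ne_zero_iff.2 (hA0 p hp hy)
    rwa [limitFunction_eq_of_tendsto hd]
  -- Constancy is so far known only on punctured neighbourhoods; continuity extends it to `p`, so
  -- that conjugate points can be compared.
  have hval : ∀ p, H.IsFinite p → H.y p ≠ 0 →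
      limitFunction f p ^ 2 * ∏ i, (H.x p - H.e i) ^ (-A (H.branchPoint i)) = c := by
    intro p hp hy
    have hne : ∀ i, H.x p - H.e i ≠ 0 := fun i h =>
      hy ((H.y_eq_zero_iff hp).2 ⟨i, sub_eq_zero.1 h⟩)
    have h1 : ContinuousAt (fun q => limitFunction f q ^ 2 *
        ∏ i, (H.x q - H.e i) ^ (-A (H.branchPoint i))) p :=
      ((hφ p hp hy).1.pow 2).mul (tendsto_finsetProd _ fun i _ =>
        (((H.continuousAt_x hp).sub continuousAt_const).zpow₀ _ (Or.inl (hne i))).tendsto)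
    refine tendsto_nhds_unique (h1.tendsto.mono_left nhdsWithin_le_nhds) (l := 𝓝[≠] p)
      (tendsto_const_nhds.congr' ?_)
    filter_upwards [hc p, hf.limitFunction_eventuallyEq p] with q h2 h3
    rw [h3, h2]
  obtain ⟨ε, hε, hsign⟩ := exists_sign hφ (fun p q hpq => by
    have h1 := hval p hpq.1 hpq.2.2.1
    have h2 := hval q hpq.2.1 (by rw [hpq.2.2.2.2, neg_ne_zero]; exact hpq.2.2.1)
    rw [hpq.2.2.2.1] at h2
    refine mul_right_cancel₀ ?_ (h2.trans h1.symm)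
    exact fun h => hc0 (by rw [← h1, h, mul_zero]))
  have hpow : ∀ i, ε = (-1) ^ A (H.branchPoint i) := fun i =>
    H.sign_eq_neg_one_zpow hf hε hsign i (hfA _)
  have hpole : ∀ b ∈ H.branchFinset, ¬ H.IsFinite b →
      A b = -∑ i, A (H.branchPoint i) ∧ H.r = 2 * g + 1 := by
    intro b hb hbf
    have h := (H.mem_branchFinset_of_pole hbf).1 hb
    refine ⟨?_, h⟩
    rw [H.sum_branchFinset _ hbf, parity, if_pos h] at hdeg
    push_cast at hdeg
    linarith
  rcases hε with rfl | rfl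
  · have h1 : ∀ i, Even (A (H.branchPoint i)) := by
      intro i
      by_contra h
      have h2 := hpow i
      rw [(Int.not_even_iff_odd.1 h).neg_one_zpow] at h2
      norm_num at h2
    refine Or.inl fun b hb => ?_
    by_cases hbf : H.IsFinite b
    · obtain ⟨i, rfl⟩ := (H.mem_branchFinset_of_finite hbf).1 hb
      exact h1 i
    · rw [(hpole b hb hbf).1, even_neg]
      exact Finset.even_sum _ fun i _ => h1 i
  · have h1 : ∀ i, Odd (A (H.branchPoint i)) := by
      intro i
      by_contra h
      have h2 := hpow i
      rw [(Int.not_odd_iff_even.1 h).neg_one_zpow] at h2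
      norm_num at h2
    refine Or.inr fun b hb => ?_
    by_cases hbf : H.IsFinite b
    · obtain ⟨i, rfl⟩ := (H.mem_branchFinset_of_finite hbf).1 hb
      exact h1 i
    · obtain ⟨h2, h3⟩ := hpole b hb hbf
      choose k hk using h1
      rw [h2, odd_neg, Finset.sum_congr rfl fun i _ => hk i, Finset.sum_add_distrib,
        ← Finset.mul_sum, Finset.sum_const, Finset.card_univ, Fintype.card_fin, nsmul_one]
      have h4 : (H.r : ℤ) = 2 * g + 1 := by exact_mod_cast h3
      -- The coefficient at infinity is minus a sum of `2g + 1` odd numbers, hence odd.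
      exact ⟨∑ i, k i + g, by rw [h4]; ring⟩

end HyperellipticModel
end RiemannSurface

/-! ### Combinatorics of the classes of branch points. -/

namespace RiemannSurface

/-- The relations between the points of the branch set `B` modulo the subgroup `P` of principal
divisors. -/
structure BranchRelations {X : Type*} (P : AddSubgroup (X →₀ ℤ)) (B : Finset X) (g : ℕ)
    (p₀ : X) : Prop where
  card_eq : B.card = 2 * g + 2
  mem : p₀ ∈ B
  single_two : ∀ b ∈ B, Finsupp.single b 2 - Finsupp.single p₀ 2 ∈ P
  sum_single : ∑ b ∈ B, Finsupp.single b 1 - (g + 1 : ℤ) • Finsupp.single p₀ 2 ∈ P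
  parity : ∀ A ∈ P, (∀ p, p ∉ B → A p = 0) →
    ∑ b ∈ B, A b = 0 ∧ ((∀ b ∈ B, Even (A b)) ∨ ∀ b ∈ B, Odd (A b))

namespace BranchRelations

variable {X : Type*} {P : AddSubgroup (X →₀ ℤ)} {B : Finset X} {g : ℕ} {p₀ : X}
  (R : BranchRelations P B g p₀)

variable (P) in
/-- The class of a point. -/
noncomputable def pointClass (b : X) : (X →₀ ℤ) ⧸ P := QuotientAddGroup.mk (Finsupp.single b 1)

theorem mk_single (b : X) (n : ℤ) :
    (QuotientAddGroup.mk (Finsupp.single b n) : (X →₀ ℤ) ⧸ P) = n • pointClass P b := by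
  rw [pointClass, ← QuotientAddGroup.mk_zsmul, Finsupp.smul_single, smul_eq_mul, mul_one]

theorem mk_sum (T : Finset X) (f : X → X →₀ ℤ) :
    (QuotientAddGroup.mk (∑ b ∈ T, f b) : (X →₀ ℤ) ⧸ P) = ∑ b ∈ T, QuotientAddGroup.mk (f b) :=
  map_sum (QuotientAddGroup.mk' P) f T

theorem mk_eq_sum {A : X →₀ ℤ} (hA : ∀ p, p ∉ B → A p = 0) :
    (QuotientAddGroup.mk A : (X →₀ ℤ) ⧸ P) = ∑ b ∈ B, A b • pointClass P b := by
  have h1 : A = ∑ b ∈ B, Finsupp.single b (A b) := by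
    have h2 : A.support ⊆ B := fun p hp => by
      by_contra h
      exact Finsupp.mem_support_iff.1 hp (hA p h)
    rw [← Finsupp.sum_of_support_subset A h2 Finsupp.single (by simp), Finsupp.sum_single]
  conv_lhs => rw [h1, mk_sum]
  exact Finset.sum_congr rfl fun b _ => mk_single b _

theorem mk_mumfordDivisor (k : ℤ) (T : Finset X) :
    (QuotientAddGroup.mk (mumfordDivisor (Finsupp.single p₀ 2) k T) : (X →₀ ℤ) ⧸ P) =
      k • (2 : ℤ) • pointClass P p₀ + ∑ b ∈ T, pointClass P b := by
  rw [mumfordDivisor, QuotientAddGroup.mk_add, QuotientAddGroup.mk_zsmul, mk_single, mk_sum]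
  rfl

open Classical in
theorem sum_single_apply (T : Finset X) (p : X) :
    (∑ b ∈ T, Finsupp.single b (1 : ℤ)) p = if p ∈ T then 1 else 0 := by
  rw [Finsupp.finsetSum_apply]
  simp [Finsupp.single_apply]

theorem sum_sum_single_apply {T : Finset X} (hT : T ⊆ B) :
    ∑ p ∈ B, (∑ b ∈ T, Finsupp.single b (1 : ℤ)) p = T.card := by
  classical
  simp_rw [sum_single_apply]
  rw [Finset.sum_ite_mem, Finset.inter_eq_right.2 hT]
  simp

theorem sum_single_apply_eq (hp₀ : p₀ ∈ B) (n : ℤ) : ∑ p ∈ B, Finsupp.single p₀ n p = n := by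
  classical
  simp [Finsupp.single_apply, hp₀]

theorem mumfordDivisor_apply_of_notMem (hp₀ : p₀ ∈ B) {k : ℤ} {T : Finset X} (hT : T ⊆ B) {p : X}
    (hp : p ∉ B) : mumfordDivisor (Finsupp.single p₀ 2) k T p = 0 := by
  classical
  rw [mumfordDivisor, Finsupp.add_apply, Finsupp.smul_apply, sum_single_apply,
    if_neg fun h => hp (hT h), Finsupp.single_eq_of_ne, smul_zero, add_zero]
  rintro rfl
  exact hp hp₀

theorem sum_mumfordDivisor_apply (hp₀ : p₀ ∈ B) (k : ℤ) {T : Finset X} (hT : T ⊆ B) :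
    ∑ p ∈ B, mumfordDivisor (Finsupp.single p₀ 2) k T p = 2 * k + T.card := by
  simp only [mumfordDivisor, Finsupp.add_apply, Finsupp.smul_apply, Finset.sum_add_distrib,
    sum_sum_single_apply hT, ← Finset.smul_sum, sum_single_apply_eq hp₀]
  rw [smul_eq_mul, mul_comm]

include R

theorem two_smul_pointClass {b : X} (hb : b ∈ B) :
    (2 : ℤ) • pointClass P b = (2 : ℤ) • pointClass P p₀ := by
  rw [← mk_single, ← mk_single, QuotientAddGroup.eq_iff_sub_mem]
  exact R.single_two b hb

theorem sum_pointClass :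
    ∑ b ∈ B, pointClass P b = (g + 1 : ℤ) • (2 : ℤ) • pointClass P p₀ := by
  rw [← mk_single, ← QuotientAddGroup.mk_zsmul]
  exact (mk_sum B _).symm.trans (QuotientAddGroup.eq_iff_sub_mem.2 R.sum_single)

/-- The sums over `T` and `B \ T` add up to `(g + 1) D`, while twice the sum over `B \ T` is `|B \
T| D`. For `|T| = g + 1` the coefficient of `D` vanishes. -/
theorem sum_pointClass_compl [DecidableEq X] {T : Finset X} (hT : T ⊆ B) :
    ∑ b ∈ T, pointClass P b =
      (g + 1 - (B \ T).card : ℤ) • (2 : ℤ) • pointClass P p₀ + ∑ b ∈ B \ T, pointClass P b := by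
  have h1 : ∑ b ∈ B \ T, pointClass P b + ∑ b ∈ T, pointClass P b = _ :=
    (Finset.sum_sdiff hT).trans R.sum_pointClass
  have h2 : ∑ b ∈ B \ T, pointClass P b + ∑ b ∈ B \ T, pointClass P b =
      ((B \ T).card : ℤ) • (2 : ℤ) • pointClass P p₀ := by
    rw [← Finset.sum_add_distrib, natCast_zsmul, ← Finset.sum_const]
    refine Finset.sum_congr rfl fun b hb => ?_
    rw [← R.two_smul_pointClass (Finset.sdiff_subset hb), two_zsmul]
  rw [sub_smul, ← h1, ← h2]
  abel

theorem exists_mk_eq {A : X →₀ ℤ} (hA : ∀ p, p ∉ B → A p = 0) :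
    ∃ (k : ℤ) (T : Finset X), T ⊆ B ∧ 2 * k + T.card = ∑ b ∈ B, A b ∧
      (QuotientAddGroup.mk A : (X →₀ ℤ) ⧸ P) =
        k • (2 : ℤ) • pointClass P p₀ + ∑ b ∈ T, pointClass P b := by
  classical
  -- `T` collects the odd coefficients. Division rounds so that remainders are 0 or 1 for negative
  -- coefficients as well.
  refine ⟨∑ b ∈ B, A b / 2, {b ∈ B | A b % 2 = 1}, Finset.filter_subset _ _, ?_, ?_⟩
  · rw [Finset.card_filter, Nat.cast_sum, Finset.mul_sum, ← Finset.sum_add_distrib]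
    refine Finset.sum_congr rfl fun b _ => ?_
    split_ifs <;> push_cast <;> omega
  · have h1 : (∑ b ∈ B, A b / 2) • (2 : ℤ) • pointClass P p₀ =
        ∑ b ∈ B, (A b / 2) • (2 : ℤ) • pointClass P p₀ :=
      map_sum (zmultiplesHom _ ((2 : ℤ) • pointClass P p₀)) _ _
    rw [mk_eq_sum hA, h1, Finset.sum_filter, ← Finset.sum_add_distrib]
    refine Finset.sum_congr rfl fun b hb => ?_
    rw [← R.two_smul_pointClass hb, smul_smul]
    conv_lhs => rw [← Int.ediv_mul_add_emod (A b) 2, add_zsmul]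
    congr 1
    rcases Int.emod_two_eq_zero_or_one (A b) with h | h <;> simp [h]

theorem exists_mk_eq_of_card_le {A : X →₀ ℤ} (hA : ∀ p, p ∉ B → A p = 0) :
    ∃ (k : ℤ) (T : Finset X), T ⊆ B ∧ T.card ≤ g + 1 ∧ 2 * k + T.card = ∑ b ∈ B, A b ∧
      (QuotientAddGroup.mk A : (X →₀ ℤ) ⧸ P) =
        k • (2 : ℤ) • pointClass P p₀ + ∑ b ∈ T, pointClass P b := by
  classical
  obtain ⟨k, T, hT, hk, h⟩ := R.exists_mk_eq hA
  by_cases hc : T.card ≤ g + 1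
  · exact ⟨k, T, hT, hc, hk, h⟩
  · have h1 := Finset.card_sdiff_add_card_eq_card hT
    rw [R.card_eq] at h1
    refine ⟨k + (g + 1 - (B \ T).card), B \ T, Finset.sdiff_subset, by omega, ?_, ?_⟩
    · rw [← hk]
      have h2 : ((B \ T).card : ℤ) + T.card = 2 * g + 2 := by exact_mod_cast h1
      linarith
    · rw [h, R.sum_pointClass_compl hT, add_zsmul, add_assoc]

/-- Modulo 2 the difference of the two divisors is the difference of the indicators of `T` and `T'`,
since `D` has even coefficients. By `parity` it is everywhere even or everywhere odd on `B`. -/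
theorem eq_or_eq_compl [DecidableEq X] {k k' : ℤ} {T T' : Finset X} (hT : T ⊆ B) (hT' : T' ⊆ B)
    (h : mumfordDivisor (Finsupp.single p₀ 2) k T - mumfordDivisor (Finsupp.single p₀ 2) k' T' ∈
      P) : 2 * k + T.card = 2 * k' + T'.card ∧ (T' = T ∨ T' = B \ T) := by
  have h1 := R.parity _ h fun p hp => by
    rw [Finsupp.sub_apply, mumfordDivisor_apply_of_notMem R.mem hT hp,
      mumfordDivisor_apply_of_notMem R.mem hT' hp, sub_zero]
  have h3 : ∀ b, ∃ m : ℤ, (mumfordDivisor (Finsupp.single p₀ 2) k T -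
      mumfordDivisor (Finsupp.single p₀ 2) k' T') b =
      2 * m + (if b ∈ T then 1 else 0) - if b ∈ T' then 1 else 0 := by
    intro b
    rw [Finsupp.sub_apply, mumfordDivisor, mumfordDivisor, Finsupp.add_apply, Finsupp.add_apply,
      Finsupp.smul_apply, Finsupp.smul_apply, sum_single_apply, sum_single_apply]
    refine ⟨if b = p₀ then k - k' else 0, ?_⟩
    rw [Finsupp.single_apply]
    simp only [eq_comm (a := p₀), smul_eq_mul]
    split_ifs <;> ring
  obtain ⟨h1, h2⟩ := h1
  simp only [Finsupp.sub_apply] at h1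
  rw [Finset.sum_sub_distrib, sum_mumfordDivisor_apply R.mem k hT,
    sum_mumfordDivisor_apply R.mem k' hT', sub_eq_zero] at h1
  refine ⟨h1, h2.imp (fun h2 => ?_) (fun h2 => ?_)⟩
  · ext b
    by_cases hb : b ∈ B
    · have h4 := h2 b hb
      obtain ⟨m, hm⟩ := h3 b
      rw [hm, Int.even_iff] at h4
      split_ifs at h4 with h5 h6 h6
      · exact ⟨fun _ => h5, fun _ => h6⟩
      · omega
      · omega
      · exact ⟨fun h => absurd h (by assumption), fun h => absurd h (by assumption)⟩
    · exact ⟨fun h => absurd (hT' h) hb, fun h => absurd (hT h) hb⟩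
  · ext b
    rw [Finset.mem_sdiff]
    by_cases hb : b ∈ B
    · have h4 := h2 b hb
      obtain ⟨m, hm⟩ := h3 b
      rw [hm, Int.odd_iff] at h4
      split_ifs at h4 with h5 h6 h6
      · omega
      · exact ⟨fun h => absurd h h6, fun h => absurd h5 h.2⟩
      · exact ⟨fun _ => ⟨hb, h5⟩, fun _ => h6⟩
      · omega
    · exact ⟨fun h => absurd (hT' h) hb, fun h => absurd h.1 hb⟩

theorem exists_mk_eq_of_notMem {A : X →₀ ℤ} (hA : ∀ p, p ∉ B → A p = 0) (p₁ : X) :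
    ∃ (k : ℤ) (T : Finset X), T ⊆ B ∧ p₁ ∉ T ∧ 2 * k + T.card = ∑ b ∈ B, A b ∧
      (QuotientAddGroup.mk A : (X →₀ ℤ) ⧸ P) =
        k • (2 : ℤ) • pointClass P p₀ + ∑ b ∈ T, pointClass P b := by
  classical
  obtain ⟨k, T, hT, hk, h⟩ := R.exists_mk_eq hA
  by_cases hp : p₁ ∉ T
  · exact ⟨k, T, hT, hp, hk, h⟩
  · have h1 := Finset.card_sdiff_add_card_eq_card hT
    rw [R.card_eq] at h1
    refine ⟨k + (g + 1 - (B \ T).card), B \ T, Finset.sdiff_subset,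
      fun h => (Finset.mem_sdiff.1 h).2 (not_not.1 hp), ?_, ?_⟩
    · rw [← hk]
      have h2 : ((B \ T).card : ℤ) + T.card = 2 * g + 2 := by exact_mod_cast h1
      linarith
    · rw [h, R.sum_pointClass_compl hT, add_zsmul, add_assoc]

/-- Representatives are indexed by the subsets of `B \ {p₀, p₁}`, a set of `2g` elements: passing to
the complement removes `p₁`, and the coefficient at `p₀` is fixed by the degree. -/
theorem ncard_classes (e : ℤ) :
    {c : (X →₀ ℤ) ⧸ P | ∃ A : X →₀ ℤ, (∀ p, p ∉ B → A p = 0) ∧ ∑ b ∈ B, A b = e ∧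
      c = QuotientAddGroup.mk A}.ncard = 2 ^ (2 * g) := by
  classical
  obtain ⟨p₁, hp₁⟩ : (B.erase p₀).Nonempty := by
    rw [← Finset.card_pos, Finset.card_erase_of_mem R.mem, R.card_eq]
    omega
  let E : Finset X → X →₀ ℤ := fun S =>
    ∑ b ∈ S, Finsupp.single b 1 + Finsupp.single p₀ (e - S.card)
  have hsub : ∀ S ∈ ((B.erase p₀).erase p₁).powerset, S ⊆ B ∧ p₀ ∉ S ∧ p₁ ∉ S := by
    intro S hS
    rw [Finset.mem_powerset] at hS
    refine ⟨fun b hb => Finset.mem_of_mem_erase (Finset.mem_of_mem_erase (hS hb)),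
      fun h => ?_, fun h => ?_⟩
    · exact Finset.ne_of_mem_erase (Finset.mem_of_mem_erase (hS h)) rfl
    · exact Finset.ne_of_mem_erase (hS h) rfl
  have hE : ∀ S b, b ≠ p₀ → E S b = if b ∈ S then 1 else 0 := by
    intro S b hb
    rw [Finsupp.add_apply, sum_single_apply, Finsupp.single_eq_of_ne hb, add_zero]
  have hEB : ∀ S ⊆ B, ∀ p, p ∉ B → E S p = 0 := by
    intro S hS p hp
    rw [hE S p (by rintro rfl; exact hp R.mem), if_neg fun h => hp (hS h)]
  have hset : {c : (X →₀ ℤ) ⧸ P | ∃ A : X →₀ ℤ, (∀ p, p ∉ B → A p = 0) ∧ ∑ b ∈ B, A b = e ∧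
      c = QuotientAddGroup.mk A} =
      (fun S => (QuotientAddGroup.mk (E S) : (X →₀ ℤ) ⧸ P)) ''
        (((B.erase p₀).erase p₁).powerset : Set (Finset X)) := by
    ext c
    constructor
    · rintro ⟨A, hA, he, rfl⟩
      obtain ⟨k, T, hT, hp₁T, hk, h⟩ := R.exists_mk_eq_of_notMem hA p₁
      refine ⟨T.erase p₀, ?_, ?_⟩
      · rw [Finset.mem_coe, Finset.mem_powerset]
        intro b hb
        rw [Finset.mem_erase] at hb
        exact Finset.mem_erase.2 ⟨fun h => hp₁T (h ▸ hb.2), Finset.mem_erase.2 ⟨hb.1, hT hb.2⟩⟩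
      · dsimp only [E]
        rw [h, QuotientAddGroup.mk_add, mk_single, mk_sum, ← he, ← hk, smul_smul]
        change ∑ b ∈ T.erase p₀, pointClass P b + _ = _
        by_cases hp₀ : p₀ ∈ T
        · have h2 : ((T.erase p₀).card : ℤ) + 1 = T.card := by
            exact_mod_cast Finset.card_erase_add_one hp₀
          rw [← Finset.sum_erase_add _ _ hp₀, ← h2,
            show 2 * k + ((T.erase p₀).card + 1) - (T.erase p₀).card = k * 2 + 1 by ring,
            add_zsmul, one_zsmul]
          abel
        · rw [Finset.erase_eq_of_notMem hp₀, add_sub_cancel_right, mul_comm, add_comm]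
    · rintro ⟨S, hS, rfl⟩
      have hS' := hsub S hS
      refine ⟨E S, hEB S hS'.1, ?_, rfl⟩
      simp only [E, Finsupp.add_apply, Finset.sum_add_distrib, sum_sum_single_apply hS'.1,
        sum_single_apply_eq R.mem]
      ring
  rw [hset, Set.InjOn.ncard_image, Set.ncard_coe_finset, Finset.card_powerset,
    Finset.card_erase_of_mem hp₁, Finset.card_erase_of_mem R.mem, R.card_eq]
  · rfl
  · intro S hS S' hS' h
    have hS1 := hsub S hS
    have hS1' := hsub S' hS'
    have hne : p₁ ≠ p₀ := Finset.ne_of_mem_erase hp₁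
    obtain ⟨-, h2⟩ := R.parity _ (QuotientAddGroup.eq_iff_sub_mem.1 h) fun p hp => by
      rw [Finsupp.sub_apply, hEB S hS1.1 p hp, hEB S' hS1'.1 p hp, sub_zero]
    -- Both representatives vanish at `p₁`, which rules out the odd alternative.
    have h3 : ∀ b ∈ B, Even ((E S - E S') b) := by
      refine h2.resolve_right fun h3 => ?_
      have := h3 p₁ (Finset.mem_of_mem_erase hp₁)
      rw [Finsupp.sub_apply, hE S p₁ hne, hE S' p₁ hne, if_neg hS1.2.2, if_neg hS1'.2.2] at this
      simp at this
    ext b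
    by_cases hb : b ∈ B ∧ b ≠ p₀
    · have h4 := h3 b hb.1
      rw [Finsupp.sub_apply, hE S b hb.2, hE S' b hb.2] at h4
      by_cases h5 : b ∈ S <;> by_cases h6 : b ∈ S' <;> simp [h5, h6] at h4 ⊢
    · exact ⟨fun h => absurd ⟨hS1.1 h, fun h' => hS1.2.1 (h' ▸ h)⟩ hb,
        fun h => absurd ⟨hS1'.1 h, fun h' => hS1'.2.1 (h' ▸ h)⟩ hb⟩

end BranchRelations
end RiemannSurface

/-! ### Spin divisors and the main theorem. -/

namespace RiemannSurface

theorem linearlyEquivalent_iff_mk_eq {X : Type*} [TopologicalSpace X] [ChartedSpace ℂ X]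
    {D E : X →₀ ℤ} : LinearlyEquivalent D E ↔ (QuotientAddGroup.mk D : DivisorClass X) =
      QuotientAddGroup.mk E := QuotientAddGroup.eq_iff_sub_mem.symm

namespace HyperellipticModel

theorem lowest_eq {g n : ℕ} (hn : 0 < n) {e : ℤ} (he : (g : ℤ) - 1 = n * e) :
    lowest g n = ((e : ℚ) - g - 1) / 2 := by
  have hn' : (n : ℚ) ≠ 0 := by exact_mod_cast hn.ne'
  have he' : (g : ℚ) - 1 = n * e := by exact_mod_cast he
  rw [lowest]
  field_simp
  linear_combination he'

variable {g : ℕ} {X : Type*} [TopologicalSpace X] [ChartedSpace ℂ X] [IsManifold 𝓘(ℂ) ω X]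
  [CompactSpace X] [T2Space X] (H : HyperellipticModel g X)

/-- Given `2k + |T| = e`, the lower bound on `k` says `|T| ≤ g + 1` and the upper bound says only
`|T| ≥ 0`. -/
theorem isAdmissible_iff {n : ℕ} (hn : 0 < n) {e : ℤ} (he : (g : ℤ) - 1 = n * e) {k : ℤ}
    {T : Finset X} : H.IsAdmissible n k T ↔
      T ⊆ H.branchFinset ∧ T.card ≤ g + 1 ∧ 2 * k + T.card = e := by
  have hn' : (0 : ℚ) < n := by exact_mod_cast hn
  have he' : (g : ℚ) - 1 = n * e := by exact_mod_cast he
  have h1 : ((g : ℚ) - 1) / (2 * n) = e / 2 := by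
    rw [he']
    field_simp
  have h2 : ((g : ℚ) - 1 - 2 * n * k) / n = e - 2 * k := by
    rw [he']
    field_simp
  rw [IsAdmissible, lowest_eq hn he, h1, h2, ← H.coe_branchFinset, Finset.coe_subset]
  have h3 : ((T.card : ℚ) = e - 2 * k) ↔ 2 * k + T.card = e := by
    rw [eq_sub_iff_add_eq, add_comm]
    exact_mod_cast Iff.rfl
  rw [h3]
  constructor
  · rintro ⟨h4, -, h5, h6⟩
    refine ⟨h5, ?_, h6⟩
    have h7 : (T.card : ℚ) ≤ g + 1 := by
      have := h3.2 h6
      linarith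
    exact_mod_cast h7
  · rintro ⟨h4, h5, h6⟩
    have h7 := h3.2 h6
    have h8 : (T.card : ℚ) ≤ g + 1 := by exact_mod_cast h5
    have h9 : (0 : ℚ) ≤ T.card := by positivity
    exact ⟨by linarith, by linarith, h4, h6⟩

variable [ConnectedSpace X]

theorem branchRelations {p₀ : X} (hp₀ : p₀ ∈ H.branchFinset) :
    BranchRelations (principalDivisors X) H.branchFinset g p₀ where
  card_eq := H.card_branchFinset
  mem := hp₀
  single_two b hb := by
    have := sub_mem (H.single_two_sub_polarDivisor_mem hb) (H.single_two_sub_polarDivisor_mem hp₀)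
    rwa [sub_sub_sub_cancel_right] at this
  sum_single := by
    have := sub_mem H.sum_branchFinset_sub_mem
      (zsmul_mem (H.single_two_sub_polarDivisor_mem hp₀) (g + 1 : ℤ))
    rwa [smul_sub, sub_sub_sub_cancel_right] at this
  parity _ hA hB := H.sum_eq_zero_and_even_or_odd hA hB

-- If `2n A ∼ (g - 1) D`, comparing degrees gives `deg A = e`. Conversely `2b ∼ D` on `B` turns `2n
-- A` into `n e D = (g - 1) D`, which is canonical.
open BranchRelations in
theorem isSpinDivisor_and_isSupportedOn_iff {n m : ℕ} (hn : 0 < n) (hm : m = 2 * n) {e : ℤ}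
    (he : (g : ℤ) - 1 = n * e) {p₀ : X} (hp₀ : p₀ ∈ H.branchFinset) (θ : X →₀ ℤ) :
    (IsSpinDivisor m θ ∧ IsSupportedOn H.branchSet θ) ↔
      ∃ A : X →₀ ℤ, (∀ p, p ∉ H.branchFinset → A p = 0) ∧ ∑ b ∈ H.branchFinset, A b = e ∧
        (QuotientAddGroup.mk θ : DivisorClass X) = QuotientAddGroup.mk A := by
  have R := H.branchRelations hp₀
  have hpolar : (QuotientAddGroup.mk ((g - 1 : ℤ) • H.polarDivisor) : DivisorClass X) =
      QuotientAddGroup.mk ((g - 1 : ℤ) • Finsupp.single p₀ 2) := by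
    rw [QuotientAddGroup.mk_zsmul, QuotientAddGroup.mk_zsmul]
    exact congrArg _ (QuotientAddGroup.eq_iff_sub_mem.2
      (H.single_two_sub_polarDivisor_mem hp₀)).symm
  constructor
  · rintro ⟨⟨K, hK, hθK⟩, A, hθA, hA⟩
    rw [linearlyEquivalent_iff_mk_eq] at hθK hθA
    rw [← H.coe_branchFinset, Finset.coe_subset] at hA
    have hA' : ∀ p, p ∉ H.branchFinset → A p = 0 := fun p hp => by
      by_contra h
      exact hp (hA (Finsupp.mem_support_iff.2 h))
    refine ⟨A, hA', ?_, hθA⟩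
    have h1 : (QuotientAddGroup.mk (m • A) : DivisorClass X) =
        QuotientAddGroup.mk ((g - 1 : ℤ) • Finsupp.single p₀ 2) := by
      rw [← hpolar, QuotientAddGroup.mk_nsmul, ← hθA, ← QuotientAddGroup.mk_nsmul, hθK]
      exact QuotientAddGroup.eq_iff_sub_mem.2
        (hK.sub_mem_principalDivisors H.isCanonicalDivisor_smul_polarDivisor)
    have h2 := (R.parity _ (QuotientAddGroup.eq_iff_sub_mem.1 h1) fun p hp => by
      rw [Finsupp.sub_apply, Finsupp.smul_apply, Finsupp.smul_apply, hA' p hp,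
        Finsupp.single_eq_of_ne, smul_zero, smul_zero, sub_zero]
      rintro rfl
      exact hp hp₀).1
    simp only [Finsupp.sub_apply, Finsupp.smul_apply] at h2
    rw [Finset.sum_sub_distrib, ← Finset.smul_sum, ← Finset.smul_sum, sum_single_apply_eq hp₀, hm,
      he, smul_eq_mul, nsmul_eq_mul] at h2
    have h3 : (2 * n : ℤ) * (∑ b ∈ H.branchFinset, A b - e) = 0 := by
      push_cast at h2
      linear_combination h2
    have h4 : (2 * n : ℤ) ≠ 0 := by positivity
    exact sub_eq_zero.1 ((mul_eq_zero.1 h3).resolve_left h4)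
  · rintro ⟨A, hA, hAe, hθA⟩
    refine ⟨⟨_, H.isCanonicalDivisor_smul_polarDivisor, ?_⟩, A, ?_, ?_⟩
    · rw [linearlyEquivalent_iff_mk_eq, hpolar, QuotientAddGroup.mk_nsmul, hθA, mk_eq_sum hA,
        QuotientAddGroup.mk_zsmul, mk_single, he, hm, ← hAe, mul_comm 2 n, mul_smul,
        ← natCast_zsmul _ n, mul_smul]
      congr 1
      rw [Finset.smul_sum]
      refine Eq.trans ?_ (map_sum (zmultiplesHom _ ((2 : ℤ) • pointClass _ p₀)) A _).symm
      refine Finset.sum_congr rfl fun b hb => ?_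
      rw [zmultiplesHom_apply, ← R.two_smul_pointClass hb, smul_comm, ← natCast_zsmul _ 2]
      rfl
    · rwa [linearlyEquivalent_iff_mk_eq]
    · rw [← H.coe_branchFinset, Finset.coe_subset]
      intro p hp
      by_contra h
      exact Finsupp.mem_support_iff.1 hp (hA p h)

end HyperellipticModel
end RiemannSurface

open RiemannSurface HyperellipticModel BranchRelations in
theorem mainTheorem6 {X : Type*} [TopologicalSpace X] [T2Space X] [CompactSpace X]
    [ConnectedSpace X] [ChartedSpace ℂ X] [IsManifold 𝓘(ℂ) ω X]
    (g n m : ℕ) (H : RiemannSurface.HyperellipticModel g X)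
    (hn : 0 < n) (hm : m = 2 * n) (hdvd : (n : ℤ) ∣ (g : ℤ) - 1)
    (D : X →₀ ℤ) (hD : ∃ p ∈ H.branchSet, D = Finsupp.single p 2) :
    -- there are `2g + 2` branch points
    H.branchSet.ncard = 2 * g + 2 ∧
    -- the `m`-spin divisors supported on the branch set are those of the stated form
    (∀ θ : X →₀ ℤ,
      (RiemannSurface.IsSpinDivisor m θ ∧ RiemannSurface.IsSupportedOn H.branchSet θ) ↔
        ∃ (k : ℤ) (T : Finset X), H.IsAdmissible n k T ∧
          RiemannSurface.LinearlyEquivalent θ (RiemannSurface.mumfordDivisor D k T)) ∧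
    -- uniqueness of the representation above the lowest value of `k`
    (∀ (k k' : ℤ) (T T' : Finset X), H.IsAdmissible n k T → H.IsAdmissible n k' T' →
      RiemannSurface.HyperellipticModel.lowest g n < (k : ℚ) →
      RiemannSurface.LinearlyEquivalent (RiemannSurface.mumfordDivisor D k T)
        (RiemannSurface.mumfordDivisor D k' T') → k' = k ∧ T' = T) ∧
    -- at the lowest value of `k`, the only relation is that between complementary subsets,
    -- which have `g + 1` elements
    (∀ (k k' : ℤ) (T T' : Finset X), H.IsAdmissible n k T → H.IsAdmissible n k' T' →
      (k : ℚ) = RiemannSurface.HyperellipticModel.lowest g n →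
      T.card = g + 1 ∧
      (RiemannSurface.LinearlyEquivalent (RiemannSurface.mumfordDivisor D k T)
        (RiemannSurface.mumfordDivisor D k' T') ↔
          k' = k ∧ (T' = T ∨ (T' : Set X) = H.branchSet \ (T : Set X)))) ∧
    -- the number of classes
    {c : RiemannSurface.DivisorClass X | ∃ θ : X →₀ ℤ, RiemannSurface.IsSpinDivisor m θ ∧
      RiemannSurface.IsSupportedOn H.branchSet θ ∧ c = QuotientAddGroup.mk θ}.ncard =
        2 ^ (2 * g) := by
  classical
  obtain ⟨p₀, hp₀, rfl⟩ := hD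
  obtain ⟨e, he⟩ := hdvd
  rw [← H.coe_branchFinset, Finset.mem_coe] at hp₀
  have R := H.branchRelations hp₀
  have hadm := fun k T => H.isAdmissible_iff hn he (k := k) (T := T)
  have hspin := H.isSpinDivisor_and_isSupportedOn_iff hn hm he hp₀
  have hlow := lowest_eq hn he
  refine ⟨?_, fun θ => ?_, fun k k' T T' hT hT' hk h => ?_, fun k k' T T' hT hT' hk => ?_, ?_⟩
  · rw [← H.coe_branchFinset, Set.ncard_coe_finset, H.card_branchFinset]
  · rw [hspin]
    constructor
    · rintro ⟨A, hA, hAe, hθ⟩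
      obtain ⟨k, T, hT, hc, hk, h⟩ := R.exists_mk_eq_of_card_le hA
      refine ⟨k, T, (hadm k T).2 ⟨hT, hc, hk.trans hAe⟩, ?_⟩
      rw [linearlyEquivalent_iff_mk_eq, hθ, h, mk_mumfordDivisor]
    · rintro ⟨k, T, hT, h⟩
      obtain ⟨hT, -, hk⟩ := (hadm k T).1 hT
      exact ⟨_, fun p hp => mumfordDivisor_apply_of_notMem hp₀ hT hp,
        (sum_mumfordDivisor_apply hp₀ k hT).trans hk, linearlyEquivalent_iff_mk_eq.1 h⟩
  · obtain ⟨hTB, -, hke⟩ := (hadm k T).1 hT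
    obtain ⟨hTB', hc', hke'⟩ := (hadm k' T').1 hT'
    -- Strict inequality makes the complement too large to be admissible, which leaves `T' = T`.
    have hlt : T.card < g + 1 := by
      rw [hlow] at hk
      have h1 : (2 * k + T.card : ℚ) = e := by exact_mod_cast hke
      have h2 : (T.card : ℚ) < g + 1 := by linarith
      exact_mod_cast h2
    rcases (R.eq_or_eq_compl hTB hTB' h).2 with rfl | rfl
    · exact ⟨by omega, rfl⟩
    · have := Finset.card_sdiff_add_card_eq_card hTB
      rw [H.card_branchFinset] at this
      omega
  · obtain ⟨hTB, -, hke⟩ := (hadm k T).1 hT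
    obtain ⟨hTB', hc', hke'⟩ := (hadm k' T').1 hT'
    have hcard : T.card = g + 1 := by
      rw [hlow] at hk
      have h1 : (2 * k + T.card : ℚ) = e := by exact_mod_cast hke
      have h2 : (T.card : ℚ) = g + 1 := by linarith
      exact_mod_cast h2
    have hcompl := Finset.card_sdiff_add_card_eq_card hTB
    rw [H.card_branchFinset] at hcompl
    refine ⟨hcard, ?_⟩
    rw [← H.coe_branchFinset, ← Finset.coe_sdiff, Finset.coe_inj]
    constructor
    · intro h
      have h1 := (R.eq_or_eq_compl hTB hTB' h).2
      refine ⟨?_, h1⟩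
      rcases h1 with rfl | rfl <;> omega
    · rintro ⟨rfl, rfl | rfl⟩
      · exact linearlyEquivalent_iff_mk_eq.2 rfl
      -- As `|B \ T| = g + 1`, complementation does not change `k`.
      · rw [linearlyEquivalent_iff_mk_eq, mk_mumfordDivisor, mk_mumfordDivisor,
          R.sum_pointClass_compl hTB,
          show (g + 1 - (H.branchFinset \ T).card : ℤ) = 0 by omega, zero_zsmul, zero_add]
  · rw [← R.ncard_classes e]
    congr 1
    ext c
    constructor
    · rintro ⟨θ, h1, h2, rfl⟩
      exact (hspin θ).1 ⟨h1, h2⟩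
    · rintro ⟨A, hA, hAe, rfl⟩
      obtain ⟨h1, h2⟩ := (hspin A).2 ⟨A, hA, hAe, rfl⟩
      exact ⟨A, h1, h2, rfl⟩
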